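/- Let $r\in\{\infty,\omega\}$ ($\omega$ meaning real-analytic), let $(M,g)$ be a real-analytic Riemannian manifold of dimension $n$, and let $\mathcal F$ be a singular foliation of $M$ of class $C^r$ and codimension $1$. That is, $\mathcal F$ is a partition of $M$ into connected immersed submanifolds (leaves) of dimension at most $n-1$, with at least one leaf of dimension exactly $n-1$, such that around every $x\in M$ there is a $C^r$ chart onto an open box $A\times B\subset\mathbb R^k\times\mathbb R^{n-k}$, where $k$ is the dimension of the leaf through $x$, in which every leaf is a union of slices $A\times\{w\}$, at most countably many for leaves of dimension $k$. The leaves of dimension $n-1$ are called nonsingular, and their union is denoted by $M_{\rm reg}$. Suppose that * $\mathcal F$ is Riemannian (its leaves are geodesically parallel): every geodesic orthogonal to a leaf at one point is orthogonal to every leaf that it meets; * every nonsingular leaf has constant mean curvature $H=\operatorname{div}\nu$, where $\nu$ is a local field of unit normals to the leaves. For $U$ open and $f:U\to\mathbb R$, the partition of $U$ induced by $f$ is the partition into the connected components of the fibres of $f$. We call $f$ an equilibrium function on $U$ if it is of class $C^r$ and both $|\nabla f|^2$ and $\Delta f$ are constant on every connected component of every fibre of $f$. For an open set $U\subset M_{\rm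 reg}$, a defining function of $\mathcal F$ on $U$ is a $C^r$ function $f:U\to\mathbb R$ without critical points such that the partition of $U$ induced by $f$ is the restriction of $\mathcal F$ to $U$. Then $\mathcal F$ is locally an equilibrium partition: 1. Every point of $M_{\rm reg}$ has an open neighbourhood $U\subset M_{\rm reg}$ with a defining function $f$ of $\mathcal F$ on $U$ that is an equilibrium function and satisfies $$|\nabla f|^2=F(f),\qquad \Delta f=G(f)\qquad\text{on }U$$ for some functions $F,G$ of class $C^r$ on $f(U)$. 2. More generally, for every open $U\subset M_{\rm reg}$, every defining function $f$ of $\mathcal F$ on $U$ is an equilibrium function on $U$, and every point of $U$ has an open neighbourhood $V\subset U$ on which $|\nabla f|^2=F(f)$ and $\Delta f=G(f)$ for some functions $F,G$ of class $C^r$ on $f(V)$. -/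

import Mathlib

open Set Manifold
open scoped ContDiff

noncomputable section

namespace RiemFol

/-- The model space `ℝⁿ`. -/
abbrev Eu (n : ℕ) : Type := EuclideanSpace ℝ (Fin n)

/-- A real-analytic Riemannian metric on an `n`-dimensional manifold. -/
abbrev Metric (n : ℕ) (M : Type*) [TopologicalSpace M] [ChartedSpace (Eu n) M]
    [IsManifold 𝓘(ℝ, Eu n) ω M] : Type _ :=
  Bundle.ContMDiffRiemannianMetric 𝓘(ℝ, Eu n) ω (Eu n)
    (fun x : M => TangentSpace 𝓘(ℝ, Eu n) x)

/-- Vector fields (no regularity imposed). -/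
abbrev VField (n : ℕ) (M : Type*) [TopologicalSpace M] [ChartedSpace (Eu n) M] : Type _ :=
  (x : M) → TangentSpace 𝓘(ℝ, Eu n) x

section Riemannian

variable {n : ℕ} {M : Type*} [TopologicalSpace M] [ChartedSpace (Eu n) M]

/-- The differential of a real function, as a linear form on the tangent space. -/
def diff (f : M → ℝ) (x : M) : TangentSpace 𝓘(ℝ, Eu n) x →L[ℝ] ℝ :=
  mfderiv 𝓘(ℝ, Eu n) 𝓘(ℝ, ℝ) f x

/-- The velocity of a curve. -/
def velocity (γ : ℝ → M) (t : ℝ) : TangentSpace 𝓘(ℝ, Eu n) (γ t) :=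
  mfderiv 𝓘(ℝ, ℝ) 𝓘(ℝ, Eu n) γ t (1 : ℝ)

/-- The coordinate expression, in the chart `φ`, of the vector field `X`. -/
def fieldInChart (φ : OpenPartialHomeomorph M (Eu n)) (X : VField n M) (z : Eu n) : Eu n :=
  mfderiv 𝓘(ℝ, Eu n) 𝓘(ℝ, Eu n) φ (φ.symm z) (X (φ.symm z))

variable [IsManifold 𝓘(ℝ, Eu n) ω M] (g : Metric n M)

/-- The gradient: the vector dual to the differential with respect to the metric
(see `inner_grad`). -/
def grad (f : M → ℝ) : VField n M := fun x => (g.inner x).inverse (diff f x)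

/-- The defining property of the gradient. -/
theorem inner_grad (f : M → ℝ) (x : M) (v : TangentSpace 𝓘(ℝ, Eu n) x) :
    g.inner x (grad g f x) v = diff f x v := by
  let A : Eu n →L[ℝ] (Eu n →L[ℝ] ℝ) := g.inner x
  have hinj : Function.Injective (A : Eu n →ₗ[ℝ] (Eu n →L[ℝ] ℝ)) := by
    rw [injective_iff_map_eq_zero]
    intro u hu
    by_contra hne
    have h1 : 0 < A u u := g.pos x u hne
    have h2 : A u = 0 := hu
    rw [h2] at h1
    simp at h1
  have hfr : Module.finrank ℝ (Eu n) = Module.finrank ℝ (Eu n →L[ℝ] ℝ) := by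
    rw [← (LinearMap.toContinuousLinearMap (𝕜 := ℝ) (E := Eu n) (F' := ℝ)).finrank_eq]
    exact Subspace.dual_finrank_eq.symm
  let e : Eu n ≃L[ℝ] (Eu n →L[ℝ] ℝ) :=
    (LinearEquiv.ofInjectiveOfFinrankEq (A : Eu n →ₗ[ℝ] (Eu n →L[ℝ] ℝ)) hinj
      hfr).toContinuousLinearEquiv
  have he : (e : Eu n →L[ℝ] (Eu n →L[ℝ] ℝ)) = A := by
    ext u w
    rfl
  have key : ∀ l : Eu n →L[ℝ] ℝ, A (A.inverse l) = l := by
    intro l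
    rw [← he, ContinuousLinearMap.inverse_equiv]
    simp
  exact congrArg (fun l : Eu n →L[ℝ] ℝ => l v) (key (diff f x))

/-- `|∇f|²`. -/
def gradSq (f : M → ℝ) (x : M) : ℝ := g.inner x (grad g f x) (grad g f x)

/-- The metric coefficients in the chart `φ`, as a bilinear form on `ℝⁿ` at each point `z` of the
target: `gᵢⱼ(z) = metricInChart g φ z eᵢ eⱼ`. -/
def metricInChart (φ : OpenPartialHomeomorph M (Eu n)) (z u v : Eu n) : ℝ :=
  g.inner (φ.symm z) (mfderiv 𝓘(ℝ, Eu n) 𝓘(ℝ, Eu n) φ.symm z u)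
    (mfderiv 𝓘(ℝ, Eu n) 𝓘(ℝ, Eu n) φ.symm z v)

/-- `det (gᵢⱼ)` in the chart `φ`. -/
def metricDet (φ : OpenPartialHomeomorph M (Eu n)) (z : Eu n) : ℝ :=
  (Matrix.of fun i j : Fin n =>
    metricInChart g φ z (EuclideanSpace.single i 1) (EuclideanSpace.single j 1)).det

/-- The Riemannian divergence `div X = (det g)^(-1/2) ∑ᵢ ∂ᵢ ((det g)^(1/2) Xⁱ)`, computed at `x`
in the preferred chart at `x` (the expression does not depend on the chart). -/
def divergence (X : VField n M) (x : M) : ℝ :=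
  (√(metricDet g (chartAt (Eu n) x) (chartAt (Eu n) x x)))⁻¹ *
    ∑ i : Fin n, fderiv ℝ
      (fun z => √(metricDet g (chartAt (Eu n) x) z) * fieldInChart (chartAt (Eu n) x) X z i)
      (chartAt (Eu n) x x) (EuclideanSpace.single i 1)

/-- The Laplace-Beltrami operator `Δf = div ∇f`. -/
def laplacian (f : M → ℝ) (x : M) : ℝ := divergence g (grad g f) x

/-- The geodesic equation at time `t` for the coordinate expression `c` of a curve in the
chart `φ`, with the index lowered: for every `w`,
`g(c'', w) + [c' c', w] = 0`, where `[u v, w] = (∂ᵤ g(v,w) + ∂ᵥ g(u,w) - ∂_w g(u,v)) / 2` is the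
Christoffel symbol of the first kind. -/
def GeodesicEqAt (φ : OpenPartialHomeomorph M (Eu n)) (c : ℝ → Eu n) (t : ℝ) : Prop :=
  ∀ w : Eu n,
    metricInChart g φ (c t) (deriv (deriv c) t) w
      + fderiv ℝ (fun z => metricInChart g φ z (deriv c t) w) (c t) (deriv c t)
      - (1 / 2) * fderiv ℝ (fun z => metricInChart g φ z (deriv c t) (deriv c t)) (c t) w = 0

/-- `γ` is a geodesic on the set `s` of times (used for open intervals): around each time it is a
`C²` curve that satisfies the (chart independent) geodesic equation in an analytic chart. -/
def IsGeodesicOn (γ : ℝ → M) (s : Set ℝ) : Prop :=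
  ∀ t ∈ s, ContinuousAt γ t ∧ ∃ φ ∈ IsManifold.maximalAtlas 𝓘(ℝ, Eu n) ω M,
    γ t ∈ φ.source ∧ ContDiffAt ℝ 2 (fun τ => φ (γ τ)) t ∧
      GeodesicEqAt g φ (fun τ => φ (γ τ)) t

end Riemannian

section Foliation

variable {n : ℕ} {M : Type*} [TopologicalSpace M] [ChartedSpace (Eu n) M]

/-- The last `n - k` coordinates of a point in a chart. -/
def transverse (k : ℕ) (φ : OpenPartialHomeomorph M (Eu n)) (y : M) :
    {i : Fin n // k ≤ i.val} → ℝ := fun i => φ y i.1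

/-- A distinguished chart of dimension `k`, for a partition of `M` into leaves (given as an
equivalence relation, with the dimensions of the leaves given by `dim`): a `C^r` chart `φ` of `M`
onto an open box, written as `A × B ⊆ ℝᵏ × ℝⁿ⁻ᵏ`, such that every leaf meets the domain of `φ`
in a union of slices `φ⁻¹(A × {w})`, the number of slices being at most countable for the leaves
of dimension `k`. -/
structure IsDistinguished (r : WithTop ℕ∞) (leaf : Setoid M) (dim : M → ℕ) (k : ℕ)
    (φ : OpenPartialHomeomorph M (Eu n)) : Prop where
  mem_atlas : φ ∈ IsManifold.maximalAtlas 𝓘(ℝ, Eu n) r M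
  box : ∃ a b : Fin n → ℝ, φ.target = {z | ∀ i, z i ∈ Ioo (a i) (b i)}
  slice : ∀ y ∈ φ.source, ∀ z ∈ φ.source, transverse k φ y = transverse k φ z → leaf y z
  countable : ∀ y ∈ φ.source, dim y = k → (transverse k φ '' {z ∈ φ.source | leaf y z}).Countable

/-- `b` lies in the plaque through `a` of a distinguished chart around `a` with domain in `U`.
The plaques through the points of a leaf are the basic open sets of the leaf for its own
(immersed submanifold) topology. -/
def PlaqueIn (r : WithTop ℕ∞) (leaf : Setoid M) (dim : M → ℕ) (U : Set M) (a b : M) : Prop :=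
  ∃ φ : OpenPartialHomeomorph M (Eu n), IsDistinguished r leaf dim (dim a) φ ∧ φ.source ⊆ U ∧
    a ∈ φ.source ∧ b ∈ φ.source ∧ transverse (dim a) φ a = transverse (dim a) φ b

variable (n) in
/-- A singular foliation of class `C^r` in the sense of Stefan: a partition of `M` into connected
immersed submanifolds (the leaves), of possibly varying dimensions, such that around every point
`x` there is a distinguished chart whose dimension is that of the leaf of `x`. -/
structure SingularFoliation (r : WithTop ℕ∞) (M : Type*) [TopologicalSpace M]
    [ChartedSpace (Eu n) M] where
  /-- Two points are related if they lie in the same leaf. -/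
  leaf : Setoid M
  /-- The dimension of the leaf through a point. -/
  dim : M → ℕ
  dim_le : ∀ x, dim x ≤ n
  dim_eq : ∀ x y, leaf x y → dim x = dim y
  exists_chart : ∀ x, ∃ φ : OpenPartialHomeomorph M (Eu n),
    IsDistinguished r leaf dim (dim x) φ ∧ x ∈ φ.source
  /-- Each leaf is connected in its own topology: its points are joined by chains of plaques. -/
  connected : ∀ x y, leaf x y → Relation.EqvGen (PlaqueIn (n := n) r leaf dim univ) x y

namespace SingularFoliation

variable {r : WithTop ℕ∞} (𝓕 : SingularFoliation n r M)

/-- `y` and `z` lie in the same leaf of the restriction of the foliation to the open set `U`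
(the leaves of the restriction are the connected components, for the leaf topology, of the
intersections of the leaves with `U`). -/
def leafIn (U : Set M) (y z : M) : Prop :=
  Relation.EqvGen (PlaqueIn (n := n) r 𝓕.leaf 𝓕.dim U) y z

/-- The union of the leaves of dimension `n - 1`. -/
def regular : Set M := {x | 𝓕.dim x + 1 = n}

/-- The foliation has codimension one: the largest dimension of a leaf is `n - 1`. -/
def IsCodimOne : Prop := (∀ x, 𝓕.dim x + 1 ≤ n) ∧ 𝓕.regular.Nonempty

/-- The vector `v` is tangent to the leaf through `x`. -/
def IsTangent (x : M) (v : TangentSpace 𝓘(ℝ, Eu n) x) : Prop :=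
  ∃ φ : OpenPartialHomeomorph M (Eu n),
    IsDistinguished r 𝓕.leaf 𝓕.dim (𝓕.dim x) φ ∧ x ∈ φ.source ∧
      ∀ i : Fin n, 𝓕.dim x ≤ i.val →
        (show Eu n from mfderiv 𝓘(ℝ, Eu n) 𝓘(ℝ, Eu n) φ x v) i = 0

/-- The partition of the open set `U` induced by `f`, that is, the partition into the connected
components of the fibres of `f` restricted to `U`, is the restriction of the foliation to `U`. -/
def RepresentedOn (U : Set M) (f : M → ℝ) : Prop :=
  ∀ y ∈ U, ∀ z ∈ U, 𝓕.leafIn U y z ↔ z ∈ connectedComponentIn (U ∩ f ⁻¹' {f y}) y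

/-- `f` is a `C^r` function without critical points on `U` representing the foliation there. -/
structure IsDefiningOn (U : Set M) (f : M → ℝ) : Prop where
  contMDiffOn : ContMDiffOn 𝓘(ℝ, Eu n) 𝓘(ℝ, ℝ) r f U
  diff_ne_zero : ∀ x ∈ U, diff (n := n) f x ≠ 0
  represents : 𝓕.RepresentedOn U f

variable [IsManifold 𝓘(ℝ, Eu n) ω M] (g : Metric n M)

/-- The vector `w` is orthogonal to the leaf through `x`. -/
def IsNormal (x : M) (w : TangentSpace 𝓘(ℝ, Eu n) x) : Prop :=
  ∀ v, 𝓕.IsTangent x v → g.inner x w v = 0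

/-- The singular foliation is Riemannian (its leaves are geodesically parallel): every geodesic
that is orthogonal to a leaf at one of its points is orthogonal to all the leaves it meets. -/
def IsRiemannian : Prop :=
  ∀ (γ : ℝ → M) (a b : ℝ), IsGeodesicOn g γ (Ioo a b) →
    ∀ s ∈ Ioo a b, ∀ t ∈ Ioo a b,
      𝓕.IsNormal g (γ s) (velocity γ s) → 𝓕.IsNormal g (γ t) (velocity γ t)

/-- `ν` is a `C^r` field of unit normals to the leaves on `V`. -/
structure IsUnitNormalOn (V : Set M) (ν : VField n M) : Prop where
  contMDiffOn : ContMDiffOn 𝓘(ℝ, Eu n) 𝓘(ℝ, Eu n).tangent r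
    (fun x => (⟨x, ν x⟩ : TangentBundle 𝓘(ℝ, Eu n) M)) V
  unit : ∀ x ∈ V, g.inner x (ν x) (ν x) = 1
  normal : ∀ x ∈ V, 𝓕.IsNormal g x (ν x)

/-- The nonsingular leaves have constant mean curvature. With respect to a local field `ν` of unit
normals, the mean curvature at `x` of the leaf through `x` (the sum of the principal curvatures) is
the trace of `v ↦ D_v ν` on the tangent space of the leaf; since `ν` has unit length this is
`div ν`. As a leaf may be one-sided, and `ν` is unique only up to sign, constancy is required
along each leaf of the restriction to any open set on which a field `ν` is given. -/
def HasConstantMeanCurvature : Prop :=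
  ∀ (V : Set M) (ν : VField n M), IsOpen V → V ⊆ 𝓕.regular → 𝓕.IsUnitNormalOn g V ν →
    ∀ y ∈ V, ∀ z ∈ V, 𝓕.leafIn V y z → divergence g ν y = divergence g ν z

end SingularFoliation

variable [IsManifold 𝓘(ℝ, Eu n) ω M] (g : Metric n M)

/-- `f` is an equilibrium function of class `C^r` on the open set `U`: both `|∇f|²` and `Δf` are
constant on every connected component of every fibre of `f` restricted to `U`. -/
structure IsEquilibriumOn (r : WithTop ℕ∞) (U : Set M) (f : M → ℝ) : Prop where
  contMDiffOn : ContMDiffOn 𝓘(ℝ, Eu n) 𝓘(ℝ, ℝ) r f U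
  gradSq_eq : ∀ y ∈ U, ∀ z ∈ connectedComponentIn (U ∩ f ⁻¹' {f y}) y,
    gradSq g f z = gradSq g f y
  laplacian_eq : ∀ y ∈ U, ∀ z ∈ connectedComponentIn (U ∩ f ⁻¹' {f y}) y,
    laplacian g f z = laplacian g f y

/-- `|∇f|² = F(f)` and `Δf = G(f)` on `U`, for functions `F`, `G` of class `C^r` on `f(U)`. -/
def IsIsoparametricOn (r : WithTop ℕ∞) (U : Set M) (f : M → ℝ) : Prop :=
  ∃ F G : ℝ → ℝ, ContDiffOn ℝ r F (f '' U) ∧ ContDiffOn ℝ r G (f '' U) ∧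
    ∀ x ∈ U, gradSq g f x = F (f x) ∧ laplacian g f x = G (f x)

end Foliation

end RiemFol

end

open RiemFol

/-! Near a regular point the last coordinate of a distinguished chart is a defining function, so
everything reduces to an arbitrary defining function `f` on an open set of regular points. The
kernel of `df` is the tangent space of the leaf, and `∇f` is normal to it.

The Riemannian condition controls `|∇f|²`. Let `c` be the geodesic starting at a point with velocity
`∇f`. It stays normal to the leaves, so `g(c', ·) = λ df` along `c`, with `λ(0) = 1`.
Differentiating at `0` and using the geodesic equation gives `Hess f(∇f, w) = 0` for every `w`
tangent to the leaf, and `Hess f(∇f, w)` is half the derivative of `|∇f|²` along `w`. Hence `|∇f|²`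
is constant on slices (`fderiv_coord_gradSq_eq_zero`, `diffAt_gradSq_eq_zero`).

For `Δf`, put `ν = ∇f / |∇f|`. Then `Δf = |∇f| div ν + ∇f(|∇f|²) / (2|∇f|²)`
(`laplacian_eq_of_unit`). The factor `div ν` is constant along leaves by the mean curvature
hypothesis. In the last term both `|∇f|²` and `f` depend only on the transverse coordinate `t` of a
chart, so `∇f(|∇f|²)` is the ratio of their `t`-derivatives times `|∇f|²`, again a function of `t`.

Since `f` has nonzero derivative in `t`, the inverse function theorem expresses `t` as a `C^r`
function of `f`, which yields `F` and `G`. Passing from slices to leaves is an induction along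
chains of plaques.

Two kinds of charts coexist: distinguished charts are only `C^r` and carry the foliation, while
metric computations take place in analytic charts. -/

noncomputable section

namespace RiemFol

set_option maxSynthPendingDepth 3

open Filter Topology

/-! ### Determinants and divergence in coordinates -/

/-- The trace of an endomorphism of `ℝⁿ`, in the standard basis. -/
def coordTrace {n : ℕ} (A : Eu n →L[ℝ] Eu n) : ℝ :=
  ∑ i : Fin n, A (EuclideanSpace.single i 1) i

theorem coordTrace_eq {n : ℕ} (A : Eu n →L[ℝ] Eu n) :
    coordTrace A = LinearMap.trace ℝ (Eu n) A := by
  rw [LinearMap.trace_eq_sum_inner _ (EuclideanSpace.basisFun (Fin n) ℝ)]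
  simp [coordTrace, EuclideanSpace.inner_single_left]

theorem coordTrace_add {n : ℕ} (A B : Eu n →L[ℝ] Eu n) :
    coordTrace (A + B) = coordTrace A + coordTrace B := by
  simp [coordTrace, Finset.sum_add_distrib]

theorem coordTrace_comm {n : ℕ} (A B : Eu n →L[ℝ] Eu n) :
    coordTrace (A ∘L B) = coordTrace (B ∘L A) := by
  rw [coordTrace_eq, coordTrace_eq]
  exact LinearMap.trace_mul_comm ℝ (A : Eu n →ₗ[ℝ] Eu n) (B : Eu n →ₗ[ℝ] Eu n)

/-- The matrix of an endomorphism of `ℝⁿ` in the standard basis. -/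
def coordMatrix {n : ℕ} : (Eu n →L[ℝ] Eu n) →ₗ[ℝ] (Fin n → Fin n → ℝ) where
  toFun A := fun i j => A (EuclideanSpace.single j 1) i
  map_add' A B := by ext; simp
  map_smul' c A := by ext; simp

theorem det_eq_det_coordMatrix {n : ℕ} (A : Eu n →L[ℝ] Eu n) :
    A.det = (Matrix.of (coordMatrix A)).det := by
  rw [ContinuousLinearMap.det, ← LinearMap.det_toMatrix (EuclideanSpace.basisFun (Fin n) ℝ).toBasis]
  congr 1

/-- The determinant is multilinear in the rows, so its derivative at the identity is a sum of
determinants of the identity with one row replaced; each of these is a diagonal entry, by Cramer's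
rule. -/
theorem hasFDerivAt_det_one (n : ℕ) :
    ∃ L : (Fin n → Fin n → ℝ) →L[ℝ] ℝ, HasFDerivAt (fun A : Fin n → Fin n → ℝ => (Matrix.of A).det)
      L (1 : Matrix (Fin n) (Fin n) ℝ) ∧ ∀ H, L H = ∑ i, H i i := by
  let D : ContinuousMultilinearMap ℝ (fun _ : Fin n => Fin n → ℝ) ℝ :=
    { toMultilinearMap := (Matrix.detRowAlternating (n := Fin n) (R := ℝ)).toMultilinearMap
      cont := by
        change Continuous fun A : Matrix (Fin n) (Fin n) ℝ => A.det
        exact Continuous.matrix_det continuous_id }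
  refine ⟨D.linearDeriv (1 : Matrix (Fin n) (Fin n) ℝ), D.hasFDerivAt _, fun H => ?_⟩
  refine (ContinuousMultilinearMap.linearDeriv_apply _ _ _).trans ?_
  refine Finset.sum_congr rfl fun i _ => ?_
  change (Matrix.updateRow (1 : Matrix (Fin n) (Fin n) ℝ) i (H i)).det = _
  rw [← Matrix.cramer_transpose_apply]
  simp

/-- Jacobi's formula. -/
theorem hasFDerivAt_det {n : ℕ} {A : Eu n → (Eu n →L[ℝ] Eu n)}
    {A' : Eu n →L[ℝ] (Eu n →L[ℝ] Eu n)} {z : Eu n} (hA : HasFDerivAt A A' z)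
    (T : Eu n ≃L[ℝ] Eu n) (hT : A z = T) :
    ∃ L : Eu n →L[ℝ] ℝ, HasFDerivAt (fun y => (A y).det) L z ∧
      ∀ u, L u = (A z).det * coordTrace ((T.symm : Eu n →L[ℝ] Eu n) ∘L A' u) := by
  obtain ⟨D, hD, hDv⟩ := hasFDerivAt_det_one n
  let C : (Eu n →L[ℝ] Eu n) →L[ℝ] (Fin n → Fin n → ℝ) := LinearMap.toContinuousLinearMap coordMatrix
  let P : (Eu n →L[ℝ] Eu n) →L[ℝ] (Eu n →L[ℝ] Eu n) :=
    ContinuousLinearMap.compL ℝ (Eu n) (Eu n) (Eu n) (T.symm : Eu n →L[ℝ] Eu n)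
  have h1 : C (P (A z)) = (1 : Matrix (Fin n) (Fin n) ℝ) := by
    ext i j
    simp [C, P, hT, coordMatrix, Matrix.one_apply]
  have h2 : HasFDerivAt (fun y => C (P (A y))) (C ∘L P ∘L A') z :=
    (C ∘L P).hasFDerivAt.comp z hA
  have h3 := ((h1 ▸ hD : HasFDerivAt (fun A : Fin n → Fin n → ℝ => (Matrix.of A).det) D
    (C (P (A z)))).comp z h2).const_mul (A z).det
  refine ⟨_, h3.congr_of_eventuallyEq (Eventually.of_forall fun y => ?_), fun u => ?_⟩
  · have : (P (A y)).det = (Matrix.of (C (P (A y)))).det := det_eq_det_coordMatrix _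
    simp only [Function.comp, ← this]
    -- Factoring out `A z` moves the base point to the identity, where the derivative of the
    -- determinant is the trace.
    have h4 : A z ∘L P (A y) = A y := by
      ext1 u; simp [P, hT]
    have h5 : (A z ∘L P (A y)).det = (A z).det * (P (A y)).det := by
      simp [ContinuousLinearMap.det]
    rw [← h5, h4]
  · simp only [smul_apply, ContinuousLinearMap.comp_apply, hDv, smul_eq_mul]
    rfl

/-- The divergence of the vector field `X` for the density `ρ`, in coordinates. -/
def coordDiv {n : ℕ} (ρ : Eu n → ℝ) (X : Eu n → Eu n) (z : Eu n) : ℝ :=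
  (ρ z)⁻¹ * ∑ i : Fin n, fderiv ℝ (fun y => ρ y * X y i) z (EuclideanSpace.single i 1)

/-- The product rule separates the logarithmic derivative of the density from the trace of the
derivative of the field. Both terms are free of the basis, which is what makes the change of
coordinates tractable. -/
theorem coordDiv_eq {n : ℕ} {ρ : Eu n → ℝ} {X : Eu n → Eu n} {z : Eu n}
    (hρ : DifferentiableAt ℝ ρ z) (hX : DifferentiableAt ℝ X z) (h0 : ρ z ≠ 0) :
    coordDiv ρ X z = fderiv ℝ ρ z (X z) / ρ z + coordTrace (fderiv ℝ X z) := by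
  have hi : ∀ i : Fin n, fderiv ℝ (fun y => ρ y * X y i) z (EuclideanSpace.single i 1)
      = X z i * fderiv ℝ ρ z (EuclideanSpace.single i 1)
        + ρ z * (fderiv ℝ X z (EuclideanSpace.single i 1)) i := by
    intro i
    have h1 : HasFDerivAt (fun y => X y i)
        ((EuclideanSpace.proj i : Eu n →L[ℝ] ℝ) ∘L fderiv ℝ X z) z :=
      (EuclideanSpace.proj i : Eu n →L[ℝ] ℝ).hasFDerivAt.comp z hX.hasFDerivAt
    rw [(hρ.hasFDerivAt.fun_mul h1).fderiv]
    simp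
    ring
  have h2 : fderiv ℝ ρ z (X z) = ∑ i, X z i * fderiv ℝ ρ z (EuclideanSpace.single i 1) := by
    conv_lhs => rw [← (EuclideanSpace.basisFun (Fin n) ℝ).sum_repr (X z)]
    simp
  simp only [coordDiv, hi, Finset.sum_add_distrib, ← h2, ← Finset.mul_sum, coordTrace]
  field_simp

theorem coordDiv_smul {n : ℕ} {ρ s : Eu n → ℝ} {X : Eu n → Eu n} {z : Eu n}
    (hρ : DifferentiableAt ℝ ρ z) (hs : DifferentiableAt ℝ s z) (hX : DifferentiableAt ℝ X z)
    (h0 : ρ z ≠ 0) :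
    coordDiv ρ (fun y => s y • X y) z = s z * coordDiv ρ X z + fderiv ℝ s z (X z) := by
  rw [coordDiv_eq hρ (hs.fun_smul hX) h0, coordDiv_eq hρ hX h0,
    (hs.hasFDerivAt.fun_smul hX.hasFDerivAt).fderiv,
    coordTrace_add]
  have h2 : fderiv ℝ s z (X z) = ∑ i, X z i * fderiv ℝ s z (EuclideanSpace.single i 1) := by
    conv_lhs => rw [← (EuclideanSpace.basisFun (Fin n) ℝ).sum_repr (X z)]
    simp
  have h3 : coordTrace ((fderiv ℝ s z).smulRight (X z)) = fderiv ℝ s z (X z) := by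
    rw [h2]; simp [coordTrace, mul_comm]
  have h4 : coordTrace (s z • fderiv ℝ X z) = s z * coordTrace (fderiv ℝ X z) := by
    simp [coordTrace, Finset.mul_sum]
  rw [h3, h4]
  simp
  ring

/-- The coordinate divergence does not depend on the coordinates. -/
theorem coordDiv_comp {n : ℕ} {τ : Eu n → Eu n} {ρ ρ' : Eu n → ℝ} {X X' : Eu n → Eu n} {z : Eu n}
    (hτ : ContDiffAt ℝ 2 τ z) (T : Eu n ≃L[ℝ] Eu n) (hT : fderiv ℝ τ z = T)
    (hρ : ∀ᶠ y in 𝓝 z, ρ y = |(fderiv ℝ τ y).det| * ρ' (τ y))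
    (hρ' : DifferentiableAt ℝ ρ' (τ z)) (h0 : ρ' (τ z) ≠ 0)
    (hX : DifferentiableAt ℝ X z) (hX' : DifferentiableAt ℝ X' (τ z))
    (hXX : ∀ᶠ y in 𝓝 z, X' (τ y) = fderiv ℝ τ y (X y)) :
    coordDiv ρ X z = coordDiv ρ' X' (τ z) := by
  have hsymm : IsSymmSndFDerivAt ℝ τ z := hτ.isSymmSndFDerivAt (by simp)
  have hτ1 : DifferentiableAt ℝ τ z := hτ.differentiableAt (by norm_num)
  have hτ2 : DifferentiableAt ℝ (fderiv ℝ τ) z :=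
    (hτ.fderiv_right (m := 1) (by norm_num)).differentiableAt (by norm_num)
  obtain ⟨L, hL, hLu⟩ := hasFDerivAt_det hτ2.hasFDerivAt T hT
  have hdet : (fderiv ℝ τ z).det ≠ 0 := by
    rw [hT]; exact (LinearEquiv.isUnit_det' T.toLinearEquiv).ne_zero
  -- The Jacobian keeps its sign near `z`, so the absolute value is multiplication by a constant `s
  -- = ±1` and can be differentiated.
  obtain ⟨s, hs0, hs⟩ : ∃ s : ℝ, s ≠ 0 ∧
      ∀ᶠ y in 𝓝 z, |(fderiv ℝ τ y).det| = s * (fderiv ℝ τ y).det := by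
    rcases lt_or_gt_of_ne hdet with h | h
    · exact ⟨-1, by norm_num, (hL.continuousAt.eventually (gt_mem_nhds h)).mono
        fun y hy => by rw [abs_of_neg hy]; ring⟩
    · exact ⟨1, by norm_num, (hL.continuousAt.eventually (lt_mem_nhds h)).mono
        fun y hy => by rw [abs_of_pos hy]; ring⟩
  have hρ2 : ρ =ᶠ[𝓝 z] fun y => (s * (fderiv ℝ τ y).det) * ρ' (τ y) := by
    filter_upwards [hρ, hs] with y h1 h2
    rw [h1, h2]
  have hρd := ((hL.const_mul s).mul
    (hρ'.hasFDerivAt.comp z hτ1.hasFDerivAt)).congr_of_eventuallyEq hρ2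
  have hρz : ρ z = s * (fderiv ℝ τ z).det * ρ' (τ z) := hρ2.self_of_nhds
  have hρ0 : ρ z ≠ 0 := by rw [hρz]; exact mul_ne_zero (mul_ne_zero hs0 hdet) h0
  rw [coordDiv_eq hρd.differentiableAt hX hρ0, coordDiv_eq hρ' hX' h0, hρd.fderiv]
  have hXz : X' (τ z) = fderiv ℝ τ z (X z) := hXX.self_of_nhds
  -- The relation `X' ∘ τ = Dτ X` is differentiated in two ways. By symmetry of the second
  -- derivative, the extra term in the trace of `DX'` is the trace of `T⁻¹ D²τ(X)`, exactly what
  -- Jacobi's formula produces from the density.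
  have hd1 : HasFDerivAt (fun y => X' (τ y)) (fderiv ℝ X' (τ z) ∘L fderiv ℝ τ z) z :=
    hX'.hasFDerivAt.comp z hτ1.hasFDerivAt
  have hd2 : HasFDerivAt (fun y => X' (τ y))
      ((fderiv ℝ τ z) ∘L fderiv ℝ X z + (fderiv ℝ (fderiv ℝ τ) z).flip (X z)) z :=
    (hτ2.hasFDerivAt.clm_apply hX.hasFDerivAt).congr_of_eventuallyEq hXX
  have hd := hd1.unique hd2
  have hflip : (fderiv ℝ (fderiv ℝ τ) z).flip (X z) = fderiv ℝ (fderiv ℝ τ) z (X z) := by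
    ext1 u
    exact hsymm.eq u (X z)
  have hX'd : fderiv ℝ X' (τ z) = (T : Eu n →L[ℝ] Eu n) ∘L
      ((fderiv ℝ X z + (T.symm : Eu n →L[ℝ] Eu n) ∘L fderiv ℝ (fderiv ℝ τ) z (X z))
        ∘L (T.symm : Eu n →L[ℝ] Eu n)) := by
    ext1 u
    have := congrArg (fun A : Eu n →L[ℝ] Eu n => A (T.symm u)) hd
    rw [hflip, hT] at this
    simpa using this
  have htr : coordTrace (fderiv ℝ X' (τ z)) = coordTrace (fderiv ℝ X z)
      + coordTrace ((T.symm : Eu n →L[ℝ] Eu n) ∘L fderiv ℝ (fderiv ℝ τ) z (X z)) := by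
    rw [hX'd, coordTrace_comm, ← coordTrace_add]
    congr 1
    ext1 u
    simp
  rw [htr, hρz, hXz]
  simp only [add_apply, smul_apply,
    ContinuousLinearMap.comp_apply, hLu, smul_eq_mul, Function.comp]
  field_simp
  ring

/-! ### Geodesics in coordinates -/

theorem contDiffAt_clm_flip {E F : Type*} [NormedAddCommGroup E] [NormedSpace ℝ E]
    [NormedAddCommGroup F] [NormedSpace ℝ F] {P : Type*} [NormedAddCommGroup P] [NormedSpace ℝ P]
    {k : WithTop ℕ∞} {B : P → (E →L[ℝ] E →L[ℝ] F)} {p : P} (hB : ContDiffAt ℝ k B p) :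
    ContDiffAt ℝ k (fun q => (B q).flip) p := by
  have hfl : ContDiff ℝ k (fun C : E →L[ℝ] E →L[ℝ] F => C.flip) :=
    LinearIsometryEquiv.contDiff (ContinuousLinearMap.flipₗᵢ ℝ E E F)
  exact hfl.contDiffAt.comp p hB

section Spray

variable {E : Type*} [NormedAddCommGroup E] [NormedSpace ℝ E]

/-- Minus the Christoffel symbols of the first kind. -/
def coordForce (G : E → (E →L[ℝ] E →L[ℝ] ℝ)) (p : E × E) : E →L[ℝ] ℝ :=
  (1 / 2 : ℝ) • ((fderiv ℝ G p.1).flip p.2).flip p.2 - fderiv ℝ G p.1 p.2 p.2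

/-- The acceleration of a geodesic, as a function of its position and velocity. -/
def coordSpray (G : E → (E →L[ℝ] E →L[ℝ] ℝ)) (p : E × E) : E :=
  (G p.1).inverse (coordForce G p)

theorem contDiffAt_coordForce {G : E → (E →L[ℝ] E →L[ℝ] ℝ)} {p : E × E}
    (hG : ContDiffAt ℝ 2 G p.1) : ContDiffAt ℝ 1 (coordForce G) p := by
  have h0 : ContDiffAt ℝ 1 (fderiv ℝ G) p.1 := hG.fderiv_right (m := 1) (by norm_num)
  have h1 : ContDiffAt ℝ 1 (fun q : E × E => fderiv ℝ G q.1) p := h0.comp p contDiffAt_fst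
  have hs : ContDiffAt ℝ 1 (fun q : E × E => q.2) p := contDiffAt_snd
  have h2 : ContDiffAt ℝ 1 (fun q : E × E => (fderiv ℝ G q.1).flip q.2) p :=
    (contDiffAt_clm_flip h1).clm_apply hs
  have h3 : ContDiffAt ℝ 1 (fun q : E × E => ((fderiv ℝ G q.1).flip q.2).flip q.2) p :=
    (contDiffAt_clm_flip h2).clm_apply hs
  have h4 : ContDiffAt ℝ 1 (fun q : E × E => fderiv ℝ G q.1 q.2 q.2) p :=
    (h1.clm_apply hs).clm_apply hs
  exact (h3.const_smul (1 / 2 : ℝ)).sub h4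

theorem contDiffAt_coordSpray [CompleteSpace E] {G : E → (E →L[ℝ] E →L[ℝ] ℝ)} {p : E × E}
    (hG : ContDiffAt ℝ 2 G p.1) (hinv : (G p.1).IsInvertible) :
    ContDiffAt ℝ 1 (coordSpray G) p := by
  have h3 : ContDiffAt ℝ 1 (fun q : E × E => G q.1) p :=
    (hG.of_le (by norm_num)).comp p contDiffAt_fst
  have h4 : ContDiffAt ℝ 1 (fun q : E × E => (G q.1).inverse) p := by
    have h5 : ContDiffAt ℝ 1 (ContinuousLinearMap.inverse (M := E) (M₂ := E →L[ℝ] ℝ)) (G p.1) :=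
      hinv.contDiffAt_map_inverse
    exact h5.comp p h3
  exact h4.clm_apply (contDiffAt_coordForce hG)

/-- A solution of a `C¹` second order equation. -/
theorem exists_second_order_solution [CompleteSpace E] {Γ : E × E → E} {s : Set E} (hs : IsOpen s)
    (hΓ : ∀ p : E × E, p.1 ∈ s → ContDiffAt ℝ 1 Γ p) {z₀ : E} (hz₀ : z₀ ∈ s) (v₀ : E) :
    ∃ c : ℝ → E, ∃ ε > 0, c 0 = z₀ ∧ deriv c 0 = v₀ ∧ ∀ t ∈ Ioo (-ε) ε,
      c t ∈ s ∧ ContDiffAt ℝ 2 c t ∧ deriv (deriv c) t = Γ (c t, deriv c t) := by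
  have hX : ContDiffAt ℝ 1 (fun p : E × E => (p.2, Γ p)) (z₀, v₀) :=
    contDiffAt_snd.prodMk (hΓ _ hz₀)
  obtain ⟨α, hα0, δ, hδ, hα⟩ :=
    hX.exists_forall_mem_closedBall_exists_eq_forall_mem_Ioo_hasDerivAt₀ 0
  simp only [zero_sub, zero_add] at hα
  have hα0c : ContinuousAt α 0 := (hα 0 ⟨by linarith, hδ⟩).continuousAt
  have hev : ∀ᶠ t in 𝓝 (0 : ℝ), (α t).1 ∈ s := by
    refine (continuous_fst.continuousAt.comp hα0c).eventually (hs.mem_nhds ?_)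
    simpa [hα0] using hz₀
  obtain ⟨η, hη, hηs⟩ := Metric.eventually_nhds_iff.1 hev
  have hmem : ∀ t ∈ Ioo (-min δ η) (min δ η), t ∈ Ioo (-δ) δ ∧ (α t).1 ∈ s := by
    intro t ht
    have h1 := min_le_left δ η
    have h2 := min_le_right δ η
    refine ⟨⟨by linarith [ht.1], by linarith [ht.2]⟩, hηs ?_⟩
    rw [Real.dist_eq, sub_zero, abs_lt]
    exact ⟨by linarith [ht.1], by linarith [ht.2]⟩
  have hd1 : ∀ t ∈ Ioo (-min δ η) (min δ η), HasDerivAt (fun τ => (α τ).1) (α t).2 t := fun t ht =>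
    (hα t (hmem t ht).1).fst
  have hd2 : ∀ t ∈ Ioo (-min δ η) (min δ η), HasDerivAt (fun τ => (α τ).2) (Γ (α t)) t := fun t ht =>
    (hα t (hmem t ht).1).snd
  have hde : ∀ t ∈ Ioo (-min δ η) (min δ η), deriv (fun τ => (α τ).1) =ᶠ[𝓝 t] fun τ => (α τ).2 :=
    fun t ht => by
      filter_upwards [isOpen_Ioo.mem_nhds ht] with τ hτ
      exact (hd1 τ hτ).deriv
  have h0 : (0 : ℝ) ∈ Ioo (-min δ η) (min δ η) := by
    have := lt_min hδ hη
    exact ⟨by linarith, this⟩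
  refine ⟨fun τ => (α τ).1, min δ η, lt_min hδ hη, by simp [hα0], ?_, fun t ht => ⟨(hmem t ht).2, ?_, ?_⟩⟩
  · rw [(hd1 0 h0).deriv, hα0]
  · have hαc : ∀ τ ∈ Ioo (-min δ η) (min δ η), ContinuousAt α τ := fun τ hτ =>
      (hα τ (hmem τ hτ).1).continuousAt
    have hΓc : ∀ τ ∈ Ioo (-min δ η) (min δ η), ContinuousAt Γ (α τ) := fun τ hτ =>
      (hΓ _ (hmem τ hτ).2).continuousAt
    have hc1 : ContDiffOn ℝ 1 (fun τ => (α τ).2) (Ioo (-min δ η) (min δ η)) := by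
      rw [show (1 : WithTop ℕ∞) = 0 + 1 from rfl, contDiffOn_succ_iff_deriv_of_isOpen isOpen_Ioo]
      refine ⟨fun τ hτ => (hd2 τ hτ).differentiableAt.differentiableWithinAt, by simp, ?_⟩
      rw [contDiffOn_zero]
      intro τ hτ
      refine ContinuousAt.continuousWithinAt ?_
      refine ContinuousAt.congr (f := fun τ => Γ (α τ)) ?_ ?_
      · exact (hΓc τ hτ).comp (hαc τ hτ)
      · filter_upwards [isOpen_Ioo.mem_nhds hτ] with τ' hτ'
        exact (hd2 τ' hτ').deriv.symm
    have hc2 : ContDiffOn ℝ 2 (fun τ => (α τ).1) (Ioo (-min δ η) (min δ η)) := by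
      rw [show (2 : WithTop ℕ∞) = 1 + 1 from rfl, contDiffOn_succ_iff_deriv_of_isOpen isOpen_Ioo]
      refine ⟨fun τ hτ => (hd1 τ hτ).differentiableAt.differentiableWithinAt, by simp, ?_⟩
      exact hc1.congr fun τ hτ => (hd1 τ hτ).deriv
    exact hc2.contDiffAt (isOpen_Ioo.mem_nhds ht)
  · rw [(hde t ht).deriv_eq, (hd2 t ht).deriv, (hd1 t ht).deriv]

/-- Local existence of geodesics, in coordinates. -/
theorem exists_coord_geodesic [CompleteSpace E] {G : E → (E →L[ℝ] E →L[ℝ] ℝ)} {s : Set E}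
    (hs : IsOpen s) (hG : ContDiffOn ℝ 2 G s) (hinv : ∀ z ∈ s, (G z).IsInvertible)
    {z₀ : E} (hz₀ : z₀ ∈ s) (v₀ : E) :
    ∃ c : ℝ → E, ∃ ε > 0, c 0 = z₀ ∧ deriv c 0 = v₀ ∧ ∀ t ∈ Ioo (-ε) ε,
      c t ∈ s ∧ ContDiffAt ℝ 2 c t ∧ ∀ w : E,
        G (c t) (deriv (deriv c) t) w + fderiv ℝ G (c t) (deriv c t) (deriv c t) w
          - (1 / 2) * fderiv ℝ G (c t) w (deriv c t) (deriv c t) = 0 := by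
  obtain ⟨c, ε, hε, h0, h1, h⟩ := exists_second_order_solution hs
    (fun p hp => contDiffAt_coordSpray (hG.contDiffAt (hs.mem_nhds hp)) (hinv _ hp)) hz₀ v₀
  refine ⟨c, ε, hε, h0, h1, fun t ht => ⟨(h t ht).1, (h t ht).2.1, fun w => ?_⟩⟩
  obtain ⟨hcs, -, hdd⟩ := h t ht
  have hGΓ : G (c t) (coordSpray G (c t, deriv c t)) = coordForce G (c t, deriv c t) := by
    obtain ⟨e, he⟩ := hinv _ hcs
    simp only [coordSpray]
    rw [← he, ContinuousLinearMap.inverse_equiv]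
    simp
  rw [hdd, hGΓ]
  simp [coordForce]

end Spray

/-! ### Geodesics normal to the fibres of a function -/

/-- If a geodesic issued from `z₀` in the direction of the gradient `W` of `f` stays normal to the
fibres of `f`, then the squared length of the gradient is stationary at `z₀` along the fibre. -/
theorem fderiv_coord_gradSq_eq_zero {E : Type*} [NormedAddCommGroup E] [NormedSpace ℝ E]
    [CompleteSpace E] {G : E → (E →L[ℝ] E →L[ℝ] ℝ)} {f : E → ℝ}
    {W : E → E} {z₀ : E} (hG : DifferentiableAt ℝ G z₀) (hf : ContDiffAt ℝ 2 f z₀)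
    (hW : DifferentiableAt ℝ W z₀) (hsymm : ∀ u v, G z₀ u v = G z₀ v u)
    (hGW : ∀ᶠ z in 𝓝 z₀, ∀ u, G z (W z) u = fderiv ℝ f z u) (h0 : fderiv ℝ f z₀ (W z₀) ≠ 0)
    {c : ℝ → E} (hc : ContDiffAt ℝ 2 c 0) (hc0 : c 0 = z₀) (hc1 : deriv c 0 = W z₀)
    (hgeo : ∀ w : E,
        G (c 0) (deriv (deriv c) 0) w + fderiv ℝ G (c 0) (deriv c 0) (deriv c 0) w
          - (1 / 2) * fderiv ℝ G (c 0) w (deriv c 0) (deriv c 0) = 0)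
    (hnor : ∀ᶠ t in 𝓝 (0 : ℝ), ∀ u, fderiv ℝ f (c t) u = 0 → G (c t) (deriv c t) u = 0)
    {w : E} (hw : fderiv ℝ f z₀ w = 0) :
    fderiv ℝ (fun z => fderiv ℝ f z (W z)) z₀ w = 0 := by
  subst hc0
  have hfs : IsSymmSndFDerivAt ℝ f (c 0) := hf.isSymmSndFDerivAt (by simp)
  have hf2 : HasFDerivAt (fderiv ℝ f) (fderiv ℝ (fderiv ℝ f) (c 0)) (c 0) :=
    ((hf.fderiv_right (m := 1) (by norm_num)).differentiableAt (by norm_num)).hasFDerivAt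
  have hcd : HasDerivAt c (deriv c 0) 0 := (hc.differentiableAt (by norm_num)).hasDerivAt
  have hcdd : HasDerivAt (deriv c) (deriv (deriv c) 0) 0 := by
    have : ContDiffAt ℝ 1 (deriv c) 0 := (hc.fderiv_right (m := 1) (by norm_num)).clm_apply contDiffAt_const
    exact (this.differentiableAt (by norm_num)).hasDerivAt
  have hGc : HasDerivAt (fun t => G (c t)) (fderiv ℝ G (c 0) (deriv c 0)) 0 :=
    hG.hasFDerivAt.comp_hasDerivAt 0 hcd
  have hWc : HasDerivAt (fun t => W (c t)) (fderiv ℝ W (c 0) (deriv c 0)) 0 :=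
    hW.hasFDerivAt.comp_hasDerivAt 0 hcd
  have hfc : HasDerivAt (fun t => fderiv ℝ f (c t)) (fderiv ℝ (fderiv ℝ f) (c 0) (deriv c 0)) 0 :=
    hf2.comp_hasDerivAt 0 hcd
  -- the covector of the velocity is a multiple of the differential
  obtain ⟨l, hl⟩ : ∃ l, HasDerivAt
      (fun t => G (c t) (deriv c t) (W (c t)) / fderiv ℝ f (c t) (W (c t))) l 0 :=
    ⟨_, ((hGc.clm_apply hcdd).clm_apply hWc).div (hfc.clm_apply hWc) h0⟩
  have hrel : ∀ᶠ t in 𝓝 (0 : ℝ), G (c t) (deriv c t) w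
      = G (c t) (deriv c t) (W (c t)) / fderiv ℝ f (c t) (W (c t)) * fderiv ℝ f (c t) w := by
    have hne : ∀ᶠ t in 𝓝 (0 : ℝ), fderiv ℝ f (c t) (W (c t)) ≠ 0 :=
      (hfc.clm_apply hWc).continuousAt.eventually_ne h0
    filter_upwards [hnor, hne] with t ht hne
    -- Removing the `W`-component of `w` gives a vector in the kernel of `df` at `c t`, to which the
    -- velocity is orthogonal.
    have := ht (w - (fderiv ℝ f (c t) w / fderiv ℝ f (c t) (W (c t))) • W (c t)) (by
      simp [div_mul_cancel₀ _ hne])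
    simp only [map_sub, map_smul, smul_eq_mul, sub_eq_zero] at this
    rw [this]; ring
  have e1 := (hGc.clm_apply hcdd).clm_apply (hasDerivAt_const (0 : ℝ) w)
  have e2 := (hl.mul (hfc.clm_apply (hasDerivAt_const (0 : ℝ) w)))
  -- The multiplier is `1` at time `0` and `df(w) = 0`, so its derivative `l` drops out: `D²f(W, w)
  -- = G(c'', w) + D_W G(W, w)`.
  have e3 := e1.unique (e2.congr_of_eventuallyEq hrel)
  have hG0 : ∀ u, G (c 0) (W (c 0)) u = fderiv ℝ f (c 0) u := hGW.self_of_nhds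
  have hl0 : G (c 0) (deriv c 0) (W (c 0)) / fderiv ℝ f (c 0) (W (c 0)) = 1 := by
    rw [hc1, hG0, div_self h0]
  simp only [hl0, map_zero, hw, add_apply] at e3
  -- differentiate the defining relation of the gradient
  have e4 : HasFDerivAt (fun z => G z (W z) (W (c 0))) _ (c 0) :=
    (hG.hasFDerivAt.clm_apply hW.hasFDerivAt).clm_apply (hasFDerivAt_const _ _)
  have e5 : HasFDerivAt (fun z => fderiv ℝ f z (W (c 0))) _ (c 0) :=
    hf2.clm_apply (hasFDerivAt_const _ _)
  have e6 := congrArg (fun A : E →L[ℝ] ℝ => A w)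
    (e4.unique (e5.congr_of_eventuallyEq (hGW.mono fun z hz => hz _)))
  have e7 := hgeo w
  have e8 := hfs.eq w (W (c 0))
  have e9 := hsymm (W (c 0)) (fderiv ℝ W (c 0) w)
  rw [(hf2.clm_apply hW.hasFDerivAt).fderiv]
  rw [hc1] at e3 e7
  simp at e3 e6 e7 ⊢
  rw [hG0] at e9
  -- The geodesic equation turns `e3` into `D²f(W, w) = ½ D_w G(W, W)`, while `e6` reads `D_w G(W,
  -- W) + df(D_w W) = D²f(w, W)`. Together they give `df(D_w W) = -D²f(w, W)`, which is the goal.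
  linarith

/-! ### Derivatives of charts and coordinate expressions -/

section Charts

variable {n : ℕ} {M : Type*} [TopologicalSpace M] [ChartedSpace (Eu n) M]

/-- The derivative of a chart, as an endomorphism of `ℝⁿ`. -/
def chartDeriv (φ : OpenPartialHomeomorph M (Eu n)) (x : M) : Eu n →L[ℝ] Eu n :=
  mfderiv 𝓘(ℝ, Eu n) 𝓘(ℝ, Eu n) φ x

/-- The derivative of the inverse of a chart, as an endomorphism of `ℝⁿ`. -/
def chartSymmDeriv (φ : OpenPartialHomeomorph M (Eu n)) (z : Eu n) : Eu n →L[ℝ] Eu n :=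
  mfderiv 𝓘(ℝ, Eu n) 𝓘(ℝ, Eu n) φ.symm z

/-- The differential of a function, as a linear form on `ℝⁿ`. -/
def diffAt (f : M → ℝ) (x : M) : Eu n →L[ℝ] ℝ := diff (n := n) f x

variable {k : WithTop ℕ∞} {φ ψ : OpenPartialHomeomorph M (Eu n)}

theorem mdifferentiable_of_mem_maximalAtlas (hk : k ≠ 0) [IsManifold 𝓘(ℝ, Eu n) k M]
    (hφ : φ ∈ IsManifold.maximalAtlas 𝓘(ℝ, Eu n) k M) :
    φ.MDifferentiable 𝓘(ℝ, Eu n) 𝓘(ℝ, Eu n) :=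
  ⟨fun _ hx => ((contMDiffOn_of_mem_maximalAtlas hφ).mdifferentiableOn hk) _ hx,
    fun _ hx => ((contMDiffOn_symm_of_mem_maximalAtlas hφ).mdifferentiableOn hk) _ hx⟩

theorem chartSymmDeriv_chartDeriv (hφ : φ.MDifferentiable 𝓘(ℝ, Eu n) 𝓘(ℝ, Eu n))
    {x : M} (hx : x ∈ φ.source) (v : Eu n) : chartSymmDeriv φ (φ x) (chartDeriv φ x v) = v :=
  congrArg (fun A : Eu n →L[ℝ] Eu n => A v) (hφ.symm_comp_deriv hx)

theorem chartDeriv_chartSymmDeriv (hφ : φ.MDifferentiable 𝓘(ℝ, Eu n) 𝓘(ℝ, Eu n))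
    {z : Eu n} (hz : z ∈ φ.target) (v : Eu n) : chartDeriv φ (φ.symm z) (chartSymmDeriv φ z v) = v :=
  congrArg (fun A : Eu n →L[ℝ] Eu n => A v) (hφ.comp_symm_deriv hz)

/-- The derivative of a chart, as an automorphism of `ℝⁿ`. -/
def chartEquiv (hφ : φ.MDifferentiable 𝓘(ℝ, Eu n) 𝓘(ℝ, Eu n)) {z : Eu n} (hz : z ∈ φ.target) :
    Eu n ≃L[ℝ] Eu n :=
  ContinuousLinearEquiv.equivOfInverse (chartSymmDeriv φ z) (chartDeriv φ (φ.symm z))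
    (fun v => chartDeriv_chartSymmDeriv hφ hz v)
    (fun v => by
      have := chartSymmDeriv_chartDeriv hφ (φ.map_target hz) v
      rwa [φ.right_inv hz] at this)

theorem fieldInChart_apply (φ : OpenPartialHomeomorph M (Eu n)) (X : VField n M) (z : Eu n) :
    fieldInChart φ X z = chartDeriv φ (φ.symm z) (X (φ.symm z)) := rfl

theorem chartSymmDeriv_fieldInChart (hφ : φ.MDifferentiable 𝓘(ℝ, Eu n) 𝓘(ℝ, Eu n))
    {z : Eu n} (hz : z ∈ φ.target) (X : VField n M) :
    chartSymmDeriv φ z (fieldInChart φ X z) = X (φ.symm z) :=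
  (chartEquiv hφ hz).apply_symm_apply (X (φ.symm z))

theorem hasFDerivAt_transition (hφ : φ.MDifferentiable 𝓘(ℝ, Eu n) 𝓘(ℝ, Eu n))
    (hψ : ψ.MDifferentiable 𝓘(ℝ, Eu n) 𝓘(ℝ, Eu n)) {z : Eu n} (hz : z ∈ φ.target)
    (hz' : φ.symm z ∈ ψ.source) :
    HasFDerivAt (fun y => ψ (φ.symm y)) (chartDeriv ψ (φ.symm z) ∘L chartSymmDeriv φ z) z := by
  have h1 : HasMFDerivAt 𝓘(ℝ, Eu n) 𝓘(ℝ, Eu n) φ.symm z (chartSymmDeriv φ z) :=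
    (hφ.mdifferentiableAt_symm hz).hasMFDerivAt
  have h2 : HasMFDerivAt 𝓘(ℝ, Eu n) 𝓘(ℝ, Eu n) ψ (φ.symm z) (chartDeriv ψ (φ.symm z)) :=
    (hψ.mdifferentiableAt hz').hasMFDerivAt
  exact (h2.comp z h1).hasFDerivAt

theorem fieldInChart_transition (hφ : φ.MDifferentiable 𝓘(ℝ, Eu n) 𝓘(ℝ, Eu n))
    (hψ : ψ.MDifferentiable 𝓘(ℝ, Eu n) 𝓘(ℝ, Eu n)) {z : Eu n} (hz : z ∈ φ.target)
    (hz' : φ.symm z ∈ ψ.source) (X : VField n M) :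
    fieldInChart ψ X (ψ (φ.symm z)) = fderiv ℝ (fun y => ψ (φ.symm y)) z (fieldInChart φ X z) := by
  rw [(hasFDerivAt_transition hφ hψ hz hz').fderiv, ContinuousLinearMap.comp_apply,
    chartSymmDeriv_fieldInChart hφ hz, fieldInChart_apply, ψ.left_inv hz']

theorem hasFDerivAt_comp_symm (hφ : φ.MDifferentiable 𝓘(ℝ, Eu n) 𝓘(ℝ, Eu n)) {f : M → ℝ} {z : Eu n}
    (hz : z ∈ φ.target) (hf : MDifferentiableAt 𝓘(ℝ, Eu n) 𝓘(ℝ, ℝ) f (φ.symm z)) :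
    HasFDerivAt (fun y => f (φ.symm y)) (diffAt f (φ.symm z) ∘L chartSymmDeriv φ z) z := by
  have h1 : HasMFDerivAt 𝓘(ℝ, Eu n) 𝓘(ℝ, Eu n) φ.symm z (chartSymmDeriv φ z) :=
    (hφ.mdifferentiableAt_symm hz).hasMFDerivAt
  have h2 : HasMFDerivAt 𝓘(ℝ, Eu n) 𝓘(ℝ, ℝ) f (φ.symm z) (diffAt f (φ.symm z)) := hf.hasMFDerivAt
  exact (h2.comp z h1).hasFDerivAt

theorem contDiffAt_comp_symm [IsManifold 𝓘(ℝ, Eu n) k M]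
    (hφ : φ ∈ IsManifold.maximalAtlas 𝓘(ℝ, Eu n) k M) {f : M → ℝ} {z : Eu n}
    (hz : z ∈ φ.target) (hf : ContMDiffAt 𝓘(ℝ, Eu n) 𝓘(ℝ, ℝ) k f (φ.symm z)) :
    ContDiffAt ℝ k (fun y => f (φ.symm y)) z := by
  rw [← contMDiffAt_iff_contDiffAt]
  exact hf.comp z (contMDiffAt_symm_of_mem_maximalAtlas hφ hz)

theorem contMDiffAt_of_comp_symm [IsManifold 𝓘(ℝ, Eu n) k M]
    (hφ : φ ∈ IsManifold.maximalAtlas 𝓘(ℝ, Eu n) k M) {f : M → ℝ} {x : M}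
    (hx : x ∈ φ.source) (hf : ContDiffAt ℝ k (fun y => f (φ.symm y)) (φ x)) :
    ContMDiffAt 𝓘(ℝ, Eu n) 𝓘(ℝ, ℝ) k f x := by
  have h1 := (contMDiffAt_iff_contDiffAt.2 hf).comp x (contMDiffAt_of_mem_maximalAtlas hφ hx)
  refine h1.congr_of_eventuallyEq ?_
  filter_upwards [φ.open_source.mem_nhds hx] with y hy
  simp [φ.left_inv hy]

theorem contDiffAt_transition [IsManifold 𝓘(ℝ, Eu n) k M]
    (hφ : φ ∈ IsManifold.maximalAtlas 𝓘(ℝ, Eu n) k M)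
    (hψ : ψ ∈ IsManifold.maximalAtlas 𝓘(ℝ, Eu n) k M) {z : Eu n} (hz : z ∈ φ.target)
    (hz' : φ.symm z ∈ ψ.source) : ContDiffAt ℝ k (fun y => ψ (φ.symm y)) z := by
  rw [← contMDiffAt_iff_contDiffAt]
  exact (contMDiffAt_of_mem_maximalAtlas hψ hz').comp z (contMDiffAt_symm_of_mem_maximalAtlas hφ hz)

/-- A vector field is smooth where its expression in a chart is. -/
theorem contMDiffAt_of_fieldInChart [IsManifold 𝓘(ℝ, Eu n) ω M]
    (hφ : φ ∈ IsManifold.maximalAtlas 𝓘(ℝ, Eu n) ω M) (hk : k + 1 ≤ ω) {X : VField n M} {x : M}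
    (hx : x ∈ φ.source) (hX : ContDiffAt ℝ k (fieldInChart φ X) (φ x)) :
    ContMDiffAt 𝓘(ℝ, Eu n) 𝓘(ℝ, Eu n).tangent k
      (fun y => (⟨y, X y⟩ : TangentBundle 𝓘(ℝ, Eu n) M)) x := by
  have hd : φ.MDifferentiable 𝓘(ℝ, Eu n) 𝓘(ℝ, Eu n) :=
    mdifferentiable_of_mem_maximalAtlas (by simp) hφ
  have h1 : ContMDiffAt 𝓘(ℝ, Eu n) 𝓘(ℝ, Eu n).tangent k
      (fun z => (⟨z, fieldInChart φ X z⟩ : TangentBundle 𝓘(ℝ, Eu n) (Eu n))) (φ x) :=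
    contMDiffAt_vectorSpace_iff_contDiffAt.2 hX
  have h2 := ContMDiffAt.mpullback_vectorField_preimage (n := ω) (f := φ) h1
    (contMDiffAt_of_mem_maximalAtlas hφ hx) ⟨hd.mfderiv hx, rfl⟩ hk
  refine h2.congr_of_eventuallyEq ?_
  filter_upwards [φ.open_source.mem_nhds hx] with y hy
  -- The base point `φ.symm (φ y)` is replaced by a variable `p`, because `X` takes values in a
  -- tangent space that depends on it.
  have key : ∀ p : M, p = y → (chartDeriv φ y).inverse (chartDeriv φ p (X p)) = X y := by
    rintro p rfl
    let e : Eu n ≃L[ℝ] Eu n := hd.mfderiv hy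
    have : chartDeriv φ p = (e : Eu n →L[ℝ] Eu n) := rfl
    rw [this, ContinuousLinearMap.inverse_equiv]
    exact e.symm_apply_apply (X p)
  exact congrArg (fun v => (⟨y, v⟩ : TangentBundle 𝓘(ℝ, Eu n) M)) (key _ (φ.left_inv hy)).symm

end Charts

/-! ### The metric in a chart -/

section Metric

variable {n : ℕ} {M : Type*} [TopologicalSpace M] [ChartedSpace (Eu n) M]
  [IsManifold 𝓘(ℝ, Eu n) ω M] (g : Metric n M)

/-- The metric at a point, as a bilinear form on `ℝⁿ`. -/
def innerAt (x : M) : Eu n →L[ℝ] Eu n →L[ℝ] ℝ := g.inner x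

/-- The metric in a chart, as a bilinear form on `ℝⁿ`. -/
def metricForm (φ : OpenPartialHomeomorph M (Eu n)) (z : Eu n) : Eu n →L[ℝ] Eu n →L[ℝ] ℝ :=
  (innerAt g (φ.symm z)).bilinearComp (chartSymmDeriv φ z) (chartSymmDeriv φ z)

theorem metricForm_apply (φ : OpenPartialHomeomorph M (Eu n)) (z u v : Eu n) :
    metricForm g φ z u v = innerAt g (φ.symm z) (chartSymmDeriv φ z u) (chartSymmDeriv φ z v) := rfl

theorem metricForm_symm (φ : OpenPartialHomeomorph M (Eu n)) (z u v : Eu n) :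
    metricForm g φ z u v = metricForm g φ z v u := g.symm _ _ _

variable {φ ψ : OpenPartialHomeomorph M (Eu n)}

theorem metricForm_pos (hφ : φ.MDifferentiable 𝓘(ℝ, Eu n) 𝓘(ℝ, Eu n)) {z : Eu n}
    (hz : z ∈ φ.target) {v : Eu n} (hv : v ≠ 0) : 0 < metricForm g φ z v v :=
  g.pos _ _ ((chartEquiv hφ hz).map_ne_zero_iff.2 hv)

theorem isInvertible_of_pos {A : Eu n →L[ℝ] Eu n →L[ℝ] ℝ} (hA : ∀ v, v ≠ 0 → 0 < A v v) :
    A.IsInvertible := by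
  have hinj : Function.Injective (A : Eu n →ₗ[ℝ] (Eu n →L[ℝ] ℝ)) := by
    rw [injective_iff_map_eq_zero]
    intro u hu
    by_contra hne
    have h1 := hA u hne
    have h2 : A u = 0 := hu
    simp [h2] at h1
  have hfr : Module.finrank ℝ (Eu n) = Module.finrank ℝ (Eu n →L[ℝ] ℝ) := by
    rw [← (LinearMap.toContinuousLinearMap (𝕜 := ℝ) (E := Eu n) (F' := ℝ)).finrank_eq]
    exact Subspace.dual_finrank_eq.symm
  exact ⟨(LinearEquiv.ofInjectiveOfFinrankEq (A : Eu n →ₗ[ℝ] (Eu n →L[ℝ] ℝ)) hinj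
    hfr).toContinuousLinearEquiv, by ext u w; rfl⟩

theorem metricForm_isInvertible (hφ : φ.MDifferentiable 𝓘(ℝ, Eu n) 𝓘(ℝ, Eu n)) {z : Eu n}
    (hz : z ∈ φ.target) : (metricForm g φ z).IsInvertible :=
  isInvertible_of_pos fun _ hv => metricForm_pos g hφ hz hv

/-- In finite dimension it suffices to test on pairs of fixed vectors `u`, `v`. The tangent map of
`φ.symm` carries these to smooth sections along `φ.symm`, and the metric pairs smooth sections
smoothly. -/
theorem contDiffOn_metricForm (hφ : φ ∈ IsManifold.maximalAtlas 𝓘(ℝ, Eu n) ω M) :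
    ContDiffOn ℝ ω (metricForm g φ) φ.target := by
  have hs := contMDiffOn_symm_of_mem_maximalAtlas hφ
  have hv : ∀ u : Eu n, ContMDiffOn 𝓘(ℝ, Eu n) 𝓘(ℝ, Eu n).tangent ω
      (fun z => (⟨φ.symm z, chartSymmDeriv φ z u⟩ : TangentBundle 𝓘(ℝ, Eu n) M)) φ.target := by
    intro u
    have h1 : ContMDiffOn 𝓘(ℝ, Eu n) 𝓘(ℝ, Eu n).tangent ω
        (fun z => (⟨z, u⟩ : TangentBundle 𝓘(ℝ, Eu n) (Eu n))) φ.target :=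
      contMDiffOn_vectorSpace_iff_contDiffOn.2 contDiffOn_const
    refine ((hs.contMDiffOn_tangentMapWithin (m := ω) le_rfl
      φ.open_target.uniqueMDiffOn).comp h1 fun z hz => hz).congr fun z hz => ?_
    simp only [Function.comp, tangentMapWithin, mfderivWithin_of_isOpen φ.open_target hz]
    rfl
  have hg := g.contMDiff.comp_contMDiffOn hs
  refine contDiffOn_clm_apply.2 fun u => contDiffOn_clm_apply.2 fun v => ?_
  have h2 := ContMDiffOn.clm_bundle_apply₂ (F₁ := Eu n) (F₂ := Eu n) (F₃ := ℝ)
    (E₁ := fun x : M => TangentSpace 𝓘(ℝ, Eu n) x) (E₂ := fun x : M => TangentSpace 𝓘(ℝ, Eu n) x)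
    (E₃ := fun _ : M => ℝ) (b := φ.symm) hg (hv u) (hv v)
  rw [← contMDiffOn_iff_contDiffOn]
  intro z hz
  have h3 := h2 z hz
  simp only [Bundle.contMDiffWithinAt_totalSpace] at h3
  exact h3.2

end Metric

/-! ### Gradient and its squared length -/

section Gradient

variable {n : ℕ} {M : Type*} [TopologicalSpace M] [ChartedSpace (Eu n) M]
  [IsManifold 𝓘(ℝ, Eu n) ω M] (g : Metric n M) {φ ψ : OpenPartialHomeomorph M (Eu n)}

theorem mdifferentiable_of_analytic (hφ : φ ∈ IsManifold.maximalAtlas 𝓘(ℝ, Eu n) ω M) :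
    φ.MDifferentiable 𝓘(ℝ, Eu n) 𝓘(ℝ, Eu n) :=
  mdifferentiable_of_mem_maximalAtlas (by simp) hφ

theorem metricForm_fieldInChart (hφ : φ.MDifferentiable 𝓘(ℝ, Eu n) 𝓘(ℝ, Eu n))
    {z : Eu n} (hz : z ∈ φ.target) (X : VField n M) (u : Eu n) :
    metricForm g φ z (fieldInChart φ X z) u
      = innerAt g (φ.symm z) (X (φ.symm z)) (chartSymmDeriv φ z u) := by
  rw [metricForm_apply, chartSymmDeriv_fieldInChart hφ hz]

theorem metricForm_grad (hφ : φ.MDifferentiable 𝓘(ℝ, Eu n) 𝓘(ℝ, Eu n))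
    {z : Eu n} (hz : z ∈ φ.target) {f : M → ℝ}
    (hf : MDifferentiableAt 𝓘(ℝ, Eu n) 𝓘(ℝ, ℝ) f (φ.symm z)) (u : Eu n) :
    metricForm g φ z (fieldInChart φ (grad g f) z) u = fderiv ℝ (fun y => f (φ.symm y)) z u := by
  rw [metricForm_fieldInChart g hφ hz, (hasFDerivAt_comp_symm hφ hz hf).fderiv]
  exact inner_grad g f _ _

theorem fieldInChart_grad (hφ : φ.MDifferentiable 𝓘(ℝ, Eu n) 𝓘(ℝ, Eu n))
    {z : Eu n} (hz : z ∈ φ.target) {f : M → ℝ}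
    (hf : MDifferentiableAt 𝓘(ℝ, Eu n) 𝓘(ℝ, ℝ) f (φ.symm z)) :
    fieldInChart φ (grad g f) z
      = (metricForm g φ z).inverse (fderiv ℝ (fun y => f (φ.symm y)) z) := by
  have h1 : metricForm g φ z (fieldInChart φ (grad g f) z) = fderiv ℝ (fun y => f (φ.symm y)) z := by
    ext1 u
    exact metricForm_grad g hφ hz hf u
  obtain ⟨e, he⟩ := metricForm_isInvertible g hφ hz
  rw [← h1, ← he, ContinuousLinearMap.inverse_equiv]
  simp

theorem gradSq_eq_diffAt (f : M → ℝ) (x : M) : gradSq g f x = diffAt f x (grad g f x) :=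
  inner_grad g f x _

theorem gradSq_comp_symm (hφ : φ.MDifferentiable 𝓘(ℝ, Eu n) 𝓘(ℝ, Eu n))
    {z : Eu n} (hz : z ∈ φ.target) {f : M → ℝ}
    (hf : MDifferentiableAt 𝓘(ℝ, Eu n) 𝓘(ℝ, ℝ) f (φ.symm z)) :
    gradSq g f (φ.symm z) = fderiv ℝ (fun y => f (φ.symm y)) z (fieldInChart φ (grad g f) z) := by
  rw [(hasFDerivAt_comp_symm hφ hz hf).fderiv, ContinuousLinearMap.comp_apply,
    chartSymmDeriv_fieldInChart hφ hz, gradSq_eq_diffAt]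

theorem grad_ne_zero_of_diff {f : M → ℝ} {x : M} (h : diff (n := n) f x ≠ 0) :
    (grad g f x : Eu n) ≠ 0 := by
  intro h0
  apply h
  ext v
  rw [← inner_grad g f x v]
  exact (congrArg (fun w : Eu n => innerAt g x w v) h0).trans
    (congrArg (fun A : Eu n →L[ℝ] ℝ => A v) (innerAt g x).map_zero)

theorem gradSq_pos {f : M → ℝ} {x : M} (h : diff (n := n) f x ≠ 0) : 0 < gradSq g f x :=
  g.pos x _ (grad_ne_zero_of_diff g h)

variable {k : WithTop ℕ∞} {U : Set M} {f : M → ℝ}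

/-- In a chart the gradient is the inverse metric applied to the differential, and inversion is
smooth at invertible maps. The condition `k + 1 ≤ k` says that differentiation loses no regularity;
it holds for `∞` and `ω`. -/
theorem contDiffAt_fieldInChart_grad (hφ : φ ∈ IsManifold.maximalAtlas 𝓘(ℝ, Eu n) ω M)
    (hk : k + 1 ≤ k) (hk0 : k ≠ 0) (hU : IsOpen U) (hf : ContMDiffOn 𝓘(ℝ, Eu n) 𝓘(ℝ, ℝ) k f U)
    {z : Eu n} (hz : z ∈ φ.target) (hzU : φ.symm z ∈ U) :
    ContDiffAt ℝ k (fieldInChart φ (grad g f)) z := by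
  have hd := mdifferentiable_of_analytic hφ
  have hkω : k ≤ ω := le_top
  have : IsManifold 𝓘(ℝ, Eu n) k M := IsManifold.of_le hkω
  have hφk : φ ∈ IsManifold.maximalAtlas 𝓘(ℝ, Eu n) k M :=
    IsManifold.maximalAtlas_subset_of_le hkω hφ
  have h1 : ContDiffAt ℝ k (fun y => f (φ.symm y)) z :=
    contDiffAt_comp_symm hφk hz (hf.contMDiffAt (hU.mem_nhds hzU))
  have h2 : ContDiffAt ℝ k (fderiv ℝ (fun y => f (φ.symm y))) z := h1.fderiv_right hk
  have h3 : ContDiffAt ℝ k (metricForm g φ) z :=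
    ((contDiffOn_metricForm g hφ).contDiffAt (φ.open_target.mem_nhds hz)).of_le hkω
  have h4 : ContDiffAt ℝ k (ContinuousLinearMap.inverse (M := Eu n) (M₂ := Eu n →L[ℝ] ℝ))
      (metricForm g φ z) := (metricForm_isInvertible g hd hz).contDiffAt_map_inverse
  have h5 : ContDiffAt ℝ k (fun y => (metricForm g φ y).inverse) z := h4.comp z h3
  refine (h5.clm_apply h2).congr_of_eventuallyEq ?_
  filter_upwards [φ.open_target.mem_nhds hz,
    (φ.continuousAt_symm hz).preimage_mem_nhds (hU.mem_nhds hzU)] with y hy hyU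
  exact fieldInChart_grad g hd hy ((hf.contMDiffAt (hU.mem_nhds hyU)).mdifferentiableAt hk0)

theorem contMDiffOn_gradSq (hk : k + 1 ≤ k) (hk0 : k ≠ 0) (hU : IsOpen U)
    (hf : ContMDiffOn 𝓘(ℝ, Eu n) 𝓘(ℝ, ℝ) k f U) :
    ContMDiffOn 𝓘(ℝ, Eu n) 𝓘(ℝ, ℝ) k (gradSq g f) U := by
  intro x hx
  refine ContMDiffAt.contMDiffWithinAt ?_
  have hkω : k ≤ ω := le_top
  have : IsManifold 𝓘(ℝ, Eu n) k M := IsManifold.of_le hkω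
  have hφ : chartAt (Eu n) x ∈ IsManifold.maximalAtlas 𝓘(ℝ, Eu n) ω M :=
    IsManifold.chart_mem_maximalAtlas x
  set φ := chartAt (Eu n) x
  have hxs : x ∈ φ.source := mem_chart_source _ x
  have hz : φ x ∈ φ.target := φ.map_source hxs
  have hzU : φ.symm (φ x) ∈ U := by rwa [φ.left_inv hxs]
  have hφk : φ ∈ IsManifold.maximalAtlas 𝓘(ℝ, Eu n) k M :=
    IsManifold.maximalAtlas_subset_of_le hkω hφ
  refine contMDiffAt_of_comp_symm hφk hxs ?_
  have h1 : ContDiffAt ℝ k (fun y => f (φ.symm y)) (φ x) :=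
    contDiffAt_comp_symm hφk hz (hf.contMDiffAt (hU.mem_nhds hzU))
  have h2 : ContDiffAt ℝ k (fderiv ℝ (fun y => f (φ.symm y))) (φ x) := h1.fderiv_right hk
  refine (h2.clm_apply
    (contDiffAt_fieldInChart_grad g hφ hk hk0 hU hf hz hzU)).congr_of_eventuallyEq ?_
  filter_upwards [φ.open_target.mem_nhds hz,
    (φ.continuousAt_symm hz).preimage_mem_nhds (hU.mem_nhds hzU)] with y hy hyU
  exact gradSq_comp_symm g (mdifferentiable_of_analytic hφ) hy
    ((hf.contMDiffAt (hU.mem_nhds hyU)).mdifferentiableAt hk0)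

end Gradient

/-! ### Divergence and Laplacian -/

section Divergence

variable {n : ℕ} {M : Type*} [TopologicalSpace M] [ChartedSpace (Eu n) M]
  [IsManifold 𝓘(ℝ, Eu n) ω M] (g : Metric n M) {φ ψ : OpenPartialHomeomorph M (Eu n)}

/-- The Gram matrix of a bilinear form on `ℝⁿ` in the standard basis. -/
def gramMatrix (A : Eu n →L[ℝ] Eu n →L[ℝ] ℝ) : Matrix (Fin n) (Fin n) ℝ :=
  Matrix.of fun i j => A (EuclideanSpace.single i 1) (EuclideanSpace.single j 1)

theorem sum_single (u : Eu n) : ∑ i, u i • (EuclideanSpace.single i (1 : ℝ) : Eu n) = u := by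
  conv_rhs => rw [← (EuclideanSpace.basisFun (Fin n) ℝ).sum_repr u]
  simp

theorem apply_eq_gramMatrix (A : Eu n →L[ℝ] Eu n →L[ℝ] ℝ) (u v : Eu n) :
    A u v = ∑ i, ∑ j, u i * gramMatrix A i j * v j := by
  conv_lhs => rw [← sum_single u, ← sum_single v]
  simp only [map_sum, map_smul, sum_apply, smul_apply, smul_eq_mul,
    gramMatrix, Matrix.of_apply, Finset.mul_sum]
  rw [Finset.sum_comm]
  refine Finset.sum_congr rfl fun i _ => Finset.sum_congr rfl fun j _ => by ring

theorem gramMatrix_bilinearComp (A : Eu n →L[ℝ] Eu n →L[ℝ] ℝ) (T : Eu n →L[ℝ] Eu n) :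
    gramMatrix (A.bilinearComp T T)
      = (Matrix.of (coordMatrix T)).transpose * gramMatrix A * Matrix.of (coordMatrix T) := by
  ext i j
  have h1 : gramMatrix (A.bilinearComp T T) i j
    = A (T (EuclideanSpace.single i 1)) (T (EuclideanSpace.single j 1)) := rfl
  rw [h1, apply_eq_gramMatrix]
  simp only [Matrix.mul_apply, Matrix.transpose_apply, Matrix.of_apply, Finset.sum_mul]
  rw [Finset.sum_comm]
  rfl

theorem det_gramMatrix_pos {A : Eu n →L[ℝ] Eu n →L[ℝ] ℝ} (hsymm : ∀ u v, A u v = A v u)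
    (hA : ∀ v, v ≠ 0 → 0 < A v v) : 0 < (gramMatrix A).det := by
  refine Matrix.PosDef.det_pos (Matrix.PosDef.of_dotProduct_mulVec_pos ?_ fun x hx => ?_)
  · ext i j
    simp [gramMatrix, hsymm (EuclideanSpace.single i 1)]
  · have h := hA (WithLp.toLp 2 x) (by simpa using hx)
    rw [apply_eq_gramMatrix] at h
    simpa [dotProduct, Matrix.mulVec, Finset.mul_sum, mul_assoc] using h

theorem metricDet_eq (φ : OpenPartialHomeomorph M (Eu n)) (z : Eu n) :
    metricDet g φ z = (gramMatrix (metricForm g φ z)).det := rfl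

theorem metricDet_pos (hφ : φ.MDifferentiable 𝓘(ℝ, Eu n) 𝓘(ℝ, Eu n)) {z : Eu n}
    (hz : z ∈ φ.target) : 0 < metricDet g φ z := by
  rw [metricDet_eq]
  exact det_gramMatrix_pos (metricForm_symm g φ z) fun _ hv => metricForm_pos g hφ hz hv

theorem contDiffOn_sqrt_metricDet (hφ : φ ∈ IsManifold.maximalAtlas 𝓘(ℝ, Eu n) ω M) :
    ContDiffOn ℝ ω (fun z => √(metricDet g φ z)) φ.target := by
  have hd := mdifferentiable_of_analytic hφ
  have hG := contDiffOn_metricForm g hφ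
  refine ContDiffOn.sqrt ?_ fun z hz => (metricDet_pos g hd hz).ne'
  have heq : metricDet g φ = fun z => ∑ σ : Equiv.Perm (Fin n), ((Equiv.Perm.sign σ : ℤ) : ℝ)
      * ∏ i, gramMatrix (metricForm g φ z) (σ i) i := by
    funext z
    rw [metricDet_eq, Matrix.det_apply']
  rw [heq]
  refine ContDiffOn.sum fun σ _ => contDiffOn_const.mul (contDiffOn_prod fun i _ => ?_)
  exact (hG.clm_apply contDiffOn_const).clm_apply contDiffOn_const

theorem metricForm_transition (hφ : φ.MDifferentiable 𝓘(ℝ, Eu n) 𝓘(ℝ, Eu n))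
    (hψ : ψ.MDifferentiable 𝓘(ℝ, Eu n) 𝓘(ℝ, Eu n)) {z : Eu n} (hz : z ∈ φ.target)
    (hz' : φ.symm z ∈ ψ.source) :
    metricForm g φ z = (metricForm g ψ (ψ (φ.symm z))).bilinearComp
      (fderiv ℝ (fun y => ψ (φ.symm y)) z) (fderiv ℝ (fun y => ψ (φ.symm y)) z) := by
  ext u v
  simp only [ContinuousLinearMap.bilinearComp_apply, metricForm_apply,
    (hasFDerivAt_transition hφ hψ hz hz').fderiv, ContinuousLinearMap.comp_apply,
    chartSymmDeriv_chartDeriv hψ hz', ψ.left_inv hz']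

/-- The Gram matrix changes by congruence, so its determinant acquires the square of the Jacobian.
This is the density rule required by `coordDiv_comp`. -/
theorem sqrt_metricDet_transition (hφ : φ.MDifferentiable 𝓘(ℝ, Eu n) 𝓘(ℝ, Eu n))
    (hψ : ψ.MDifferentiable 𝓘(ℝ, Eu n) 𝓘(ℝ, Eu n)) {z : Eu n} (hz : z ∈ φ.target)
    (hz' : φ.symm z ∈ ψ.source) :
    √(metricDet g φ z) = |(fderiv ℝ (fun y => ψ (φ.symm y)) z).det|
      * √(metricDet g ψ (ψ (φ.symm z))) := by
  rw [metricDet_eq, metricForm_transition g hφ hψ hz hz', gramMatrix_bilinearComp, Matrix.det_mul,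
    Matrix.det_mul, Matrix.det_transpose, ← det_eq_det_coordMatrix, metricDet_eq, mul_right_comm,
    Real.sqrt_mul (mul_self_nonneg _), Real.sqrt_mul_self_eq_abs]

/-- The divergence can be computed in any analytic chart. -/
theorem divergence_eq_coordDiv (hψ : ψ ∈ IsManifold.maximalAtlas 𝓘(ℝ, Eu n) ω M) {X : VField n M}
    {x : M} (hx : x ∈ ψ.source)
    (hX : ∀ φ ∈ IsManifold.maximalAtlas 𝓘(ℝ, Eu n) ω M, x ∈ φ.source →
      DifferentiableAt ℝ (fieldInChart φ X) (φ x)) :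
    divergence g X x = coordDiv (fun z => √(metricDet g ψ z)) (fieldInChart ψ X) (ψ x) := by
  have hφ : chartAt (Eu n) x ∈ IsManifold.maximalAtlas 𝓘(ℝ, Eu n) ω M :=
    IsManifold.chart_mem_maximalAtlas x
  have hxs : x ∈ (chartAt (Eu n) x).source := mem_chart_source _ x
  change coordDiv (fun z => √(metricDet g (chartAt (Eu n) x) z))
    (fieldInChart (chartAt (Eu n) x) X) (chartAt (Eu n) x x) = _
  generalize chartAt (Eu n) x = φ at hφ hxs
  have hdφ := mdifferentiable_of_analytic hφ
  have hdψ := mdifferentiable_of_analytic hψ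
  have hz : φ x ∈ φ.target := φ.map_source hxs
  have hz' : φ.symm (φ x) ∈ ψ.source := by rwa [φ.left_inv hxs]
  have hev : ∀ᶠ y in 𝓝 (φ x), y ∈ φ.target ∧ φ.symm y ∈ ψ.source :=
    (φ.open_target.eventually_mem hz).and
      ((φ.continuousAt_symm hz).preimage_mem_nhds (ψ.open_source.mem_nhds hz'))
  have hτ : ContDiffAt ℝ 2 (fun y => ψ (φ.symm y)) (φ x) :=
    (contDiffAt_transition hφ hψ hz hz').of_le le_top
  let T : Eu n ≃L[ℝ] Eu n := (chartEquiv hdφ hz).trans (hdψ.mfderiv hz' : Eu n ≃L[ℝ] Eu n)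
  have hT : fderiv ℝ (fun y => ψ (φ.symm y)) (φ x) = T := by
    rw [(hasFDerivAt_transition hdφ hdψ hz hz').fderiv]
    rfl
  have hψx : ψ (φ.symm (φ x)) = ψ x := by rw [φ.left_inv hxs]
  have hmem : ψ x ∈ ψ.target := ψ.map_source hx
  have key := coordDiv_comp (ρ := fun z => √(metricDet g φ z)) (ρ' := fun z => √(metricDet g ψ z))
    (X := fieldInChart φ X) (X' := fieldInChart ψ X) hτ T hT
    (hev.mono fun y hy => sqrt_metricDet_transition g hdφ hdψ hy.1 hy.2)
    (by
      rw [hψx]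
      exact ((contDiffOn_sqrt_metricDet g hψ).contDiffAt
        (ψ.open_target.mem_nhds hmem)).differentiableAt (by simp))
    (by
      rw [hψx]
      exact (Real.sqrt_pos.2 (metricDet_pos g hdψ hmem)).ne')
    (hX φ hφ hxs) (by rw [hψx]; exact hX ψ hψ hx)
    (hev.mono fun y hy => fieldInChart_transition hdφ hdψ hy.1 hy.2 X)
  rw [key, hψx]

variable {k : WithTop ℕ∞} {U : Set M} {f : M → ℝ}

theorem contDiffAt_coordDiv {ρ : Eu n → ℝ} {X : Eu n → Eu n} {z : Eu n} (hk : k + 1 ≤ k)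
    (hρ : ContDiffAt ℝ k ρ z) (hX : ContDiffAt ℝ k X z) (h0 : ρ z ≠ 0) :
    ContDiffAt ℝ k (coordDiv ρ X) z := by
  refine (hρ.inv h0).mul (ContDiffAt.sum fun i _ => ?_)
  have h1 : ContDiffAt ℝ k (fun y => ρ y * X y i) z :=
    hρ.mul ((EuclideanSpace.proj i : Eu n →L[ℝ] ℝ).contDiff.contDiffAt.comp z hX)
  exact (h1.fderiv_right hk).clm_apply contDiffAt_const

/-- The divergence at `y` is defined in the preferred chart at `y`, which may jump as `y` varies.
Chart independence lets one fixed chart serve a whole neighbourhood, where the coordinate formula is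
visibly smooth. -/
theorem contMDiffOn_laplacian (hk : k + 1 ≤ k) (hk0 : k ≠ 0) (hU : IsOpen U)
    (hf : ContMDiffOn 𝓘(ℝ, Eu n) 𝓘(ℝ, ℝ) k f U) :
    ContMDiffOn 𝓘(ℝ, Eu n) 𝓘(ℝ, ℝ) k (laplacian g f) U := by
  intro x hx
  refine ContMDiffAt.contMDiffWithinAt ?_
  have hkω : k ≤ ω := le_top
  have : IsManifold 𝓘(ℝ, Eu n) k M := IsManifold.of_le hkω
  have hφ : chartAt (Eu n) x ∈ IsManifold.maximalAtlas 𝓘(ℝ, Eu n) ω M :=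
    IsManifold.chart_mem_maximalAtlas x
  have hxs : x ∈ (chartAt (Eu n) x).source := mem_chart_source _ x
  generalize chartAt (Eu n) x = φ at hφ hxs
  have hz : φ x ∈ φ.target := φ.map_source hxs
  have hzU : φ.symm (φ x) ∈ U := by rwa [φ.left_inv hxs]
  refine contMDiffAt_of_comp_symm (IsManifold.maximalAtlas_subset_of_le hkω hφ) hxs ?_
  refine (contDiffAt_coordDiv (X := fieldInChart φ (grad g f)) hk
    (((contDiffOn_sqrt_metricDet g hφ).contDiffAt (φ.open_target.mem_nhds hz)).of_le hkω)
    (contDiffAt_fieldInChart_grad g hφ hk hk0 hU hf hz hzU)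
    (Real.sqrt_pos.2 (metricDet_pos g (mdifferentiable_of_analytic hφ) hz)).ne').congr_of_eventuallyEq ?_
  filter_upwards [φ.open_target.mem_nhds hz,
    (φ.continuousAt_symm hz).preimage_mem_nhds (hU.mem_nhds hzU)] with y hy hyU
  rw [laplacian, divergence_eq_coordDiv g hφ (φ.map_target hy), φ.right_inv hy]
  intro ψ hψ hyψ
  refine (contDiffAt_fieldInChart_grad g hψ hk hk0 hU hf (ψ.map_source hyψ) ?_).differentiableAt hk0
  rwa [ψ.left_inv hyψ]

/-- `Δf = |∇f| div ν + ∇f(|∇f|) / |∇f|`, with `ν = ∇f / |∇f|`. -/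
theorem laplacian_eq_of_unit (hk : k + 1 ≤ k) (hk0 : k ≠ 0) (hU : IsOpen U)
    (hf : ContMDiffOn 𝓘(ℝ, Eu n) 𝓘(ℝ, ℝ) k f U) {x : M} (hx : x ∈ U)
    (h0 : diff (n := n) f x ≠ 0) :
    laplacian g f x = √(gradSq g f x) *
        divergence g (fun y => (√(gradSq g f y))⁻¹ • grad g f y) x
      + diffAt (gradSq g f) x (grad g f x) / (2 * gradSq g f x) := by
  have hφ : chartAt (Eu n) x ∈ IsManifold.maximalAtlas 𝓘(ℝ, Eu n) ω M :=
    IsManifold.chart_mem_maximalAtlas x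
  have hxs : x ∈ (chartAt (Eu n) x).source := mem_chart_source _ x
  have e1 : laplacian g f x = coordDiv (fun z => √(metricDet g (chartAt (Eu n) x) z))
    (fieldInChart (chartAt (Eu n) x) (grad g f)) (chartAt (Eu n) x x) := rfl
  have e2 : divergence g (fun y => (√(gradSq g f y))⁻¹ • grad g f y) x =
    coordDiv (fun z => √(metricDet g (chartAt (Eu n) x) z))
    (fieldInChart (chartAt (Eu n) x) (fun y => (√(gradSq g f y))⁻¹ • grad g f y))
    (chartAt (Eu n) x x) := rfl
  rw [e1, e2]
  clear e1 e2
  generalize chartAt (Eu n) x = φ at hφ hxs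
  have hd := mdifferentiable_of_analytic hφ
  have hz : φ x ∈ φ.target := φ.map_source hxs
  have hzx : φ.symm (φ x) = x := φ.left_inv hxs
  have hzU : φ.symm (φ x) ∈ U := by rwa [hzx]
  have hpos : 0 < gradSq g f x := gradSq_pos g h0
  have hWd : DifferentiableAt ℝ (fieldInChart φ (grad g f)) (φ x) :=
    (contDiffAt_fieldInChart_grad g hφ hk hk0 hU hf hz hzU).differentiableAt hk0
  have hSm : MDifferentiableAt 𝓘(ℝ, Eu n) 𝓘(ℝ, ℝ) (gradSq g f) (φ.symm (φ x)) :=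
    ((contMDiffOn_gradSq g hk hk0 hU hf).contMDiffAt (hU.mem_nhds hzU)).mdifferentiableAt hk0
  have hS := hasFDerivAt_comp_symm hd hz hSm
  have hS0 : gradSq g f (φ.symm (φ x)) ≠ 0 := by rw [hzx]; exact hpos.ne'
  have hs0 : √(gradSq g f (φ.symm (φ x))) ≠ 0 := Real.sqrt_ne_zero'.2 (by rwa [hzx])
  have ht : HasFDerivAt (fun z => (√(gradSq g f (φ.symm z)))⁻¹) _ (φ x) :=
    HasDerivAt.comp_hasFDerivAt (f := fun z => √(gradSq g f (φ.symm z))) (φ x)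
      (hasDerivAt_inv hs0) (hS.sqrt hS0)
  have hfield : fieldInChart φ (fun y => (√(gradSq g f y))⁻¹ • grad g f y)
      = fun z => (√(gradSq g f (φ.symm z)))⁻¹ • fieldInChart φ (grad g f) z := by
    funext z
    exact (chartDeriv φ (φ.symm z)).map_smul _ _
  have hρ : DifferentiableAt ℝ (fun z => √(metricDet g φ z)) (φ x) :=
    ((contDiffOn_sqrt_metricDet g hφ).contDiffAt (φ.open_target.mem_nhds hz)).differentiableAt
      (by simp)
  rw [hfield, coordDiv_smul hρ ht.differentiableAt hWd
    (Real.sqrt_pos.2 (metricDet_pos g hd hz)).ne', ht.fderiv]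
  simp only [smul_apply, ContinuousLinearMap.comp_apply, chartSymmDeriv_fieldInChart hd hz,
    smul_eq_mul, hzx]
  rw [show diffAt (gradSq g f) x (grad g f (φ.symm (φ x))) = diffAt (gradSq g f) x (grad g f x) from
    congrArg (fun y => diffAt (gradSq g f) x (grad g f y : Eu n)) hzx]
  have hs := Real.sqrt_pos.2 hpos
  have hsq := Real.sq_sqrt hpos.le
  generalize diffAt (gradSq g f) x (grad g f x) = D
  rw [← hsq]
  simp only [Real.sqrt_sq hs.le]
  field_simp
  ring

end Divergence

/-! ### Boxes and slices -/

section Boxes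

variable {n : ℕ}

/-- An open box in `ℝⁿ`. -/
def boxSet (a b : Fin n → ℝ) : Set (Eu n) := {z | ∀ i, z i ∈ Ioo (a i) (b i)}

theorem convex_boxSet (a b : Fin n → ℝ) : Convex ℝ (boxSet a b) := by
  intro x hx y hy s t hs ht hst i
  exact convex_Ioo (a i) (b i) (hx i) (hy i) hs ht hst

theorem isOpen_boxSet (a b : Fin n → ℝ) : IsOpen (boxSet a b) := by
  simp only [boxSet, ofPred_forall]
  exact isOpen_iInter_of_finite fun i => isOpen_Ioo.preimage (by fun_prop)

theorem exists_boxSet_subset {s : Set (Eu n)} {z : Eu n} (hs : s ∈ 𝓝 z) :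
    ∃ a b : Fin n → ℝ, z ∈ boxSet a b ∧ boxSet a b ⊆ s := by
  have hc : ContinuousAt (EuclideanSpace.equiv (Fin n) ℝ).symm (EuclideanSpace.equiv (Fin n) ℝ z) :=
    (EuclideanSpace.equiv (Fin n) ℝ).symm.continuous.continuousAt
  have h1 : (EuclideanSpace.equiv (Fin n) ℝ).symm ⁻¹' s ∈ 𝓝 (EuclideanSpace.equiv (Fin n) ℝ z) :=
    hc.preimage_mem_nhds (by simpa using hs)
  obtain ⟨ε, hε, hball⟩ := Metric.mem_nhds_iff.1 h1
  refine ⟨fun i => z i - ε, fun i => z i + ε, fun i => ⟨by linarith, by linarith⟩, fun y hy => ?_⟩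
  have h2 : EuclideanSpace.equiv (Fin n) ℝ y ∈ Metric.ball (EuclideanSpace.equiv (Fin n) ℝ z) ε := by
    rw [Metric.mem_ball, dist_pi_lt_iff hε]
    intro i
    rw [Real.dist_eq, abs_lt]
    have h3 : z i - ε < y i ∧ y i < z i + ε := hy i
    change -ε < y i - z i ∧ y i - z i < ε
    exact ⟨by linarith [h3.1], by linarith [h3.2]⟩
  simpa using hball h2

end Boxes

section Slices

variable {n : ℕ} {M : Type*} [TopologicalSpace M] {k : ℕ} {φ : OpenPartialHomeomorph M (Eu n)}

theorem transverse_eq_iff (φ : OpenPartialHomeomorph M (Eu n)) {i₀ : Fin n} (hi₀ : i₀.val + 1 = n)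
    (hk : k + 1 = n) {y z : M} : transverse k φ y = transverse k φ z ↔ φ y i₀ = φ z i₀ := by
  constructor
  · intro h
    exact congrFun h ⟨i₀, by omega⟩
  · intro h
    funext ⟨i, hi⟩
    have : i = i₀ := Fin.ext (by have := i.isLt; omega)
    subst this
    exact h

/-- The slice is the image under `φ.symm` of a box intersected with a hyperplane, a convex set. -/
theorem isPreconnected_slice (hbox : ∃ a b : Fin n → ℝ, φ.target = {z | ∀ i, z i ∈ Ioo (a i) (b i)})
    (i₀ : Fin n) (c : ℝ) : IsPreconnected (φ.source ∩ {p | φ p i₀ = c}) := by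
  obtain ⟨a, b, hab⟩ := hbox
  have h1 : Convex ℝ (φ.target ∩ {z : Eu n | z i₀ = c}) := by
    rw [hab]
    refine (convex_boxSet a b).inter ?_
    exact convex_hyperplane (f := fun z : Eu n => z i₀) ⟨by simp, by simp⟩ c
  have h2 : φ.source ∩ {p | φ p i₀ = c} = φ.symm '' (φ.target ∩ {z : Eu n | z i₀ = c}) := by
    ext p
    constructor
    · rintro ⟨hp, hc⟩
      exact ⟨φ p, ⟨φ.map_source hp, hc⟩, φ.left_inv hp⟩
    · rintro ⟨z, ⟨hz, hc⟩, rfl⟩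
      exact ⟨φ.map_target hz, by simpa [φ.right_inv hz] using hc⟩
  rw [h2]
  exact h1.isPreconnected.image _ (φ.continuousOn_symm.mono inter_subset_left)

theorem continuousOn_transverse (k : ℕ) (φ : OpenPartialHomeomorph M (Eu n)) :
    ContinuousOn (transverse k φ) φ.source := by
  refine continuousOn_pi.2 fun i => ?_
  have h : Continuous fun z : Eu n => z i.1 := by fun_prop
  exact h.comp_continuousOn φ.continuousOn

end Slices

/-! ### Distinguished charts and functions constant on slices -/

section Distinguished

variable {n : ℕ} {r : WithTop ℕ∞} {M : Type*} [TopologicalSpace M] [ChartedSpace (Eu n) M]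
  {leaf : Setoid M} {dim : M → ℕ} {k : ℕ} {φ ψ : OpenPartialHomeomorph M (Eu n)}

/-- Restriction to a smaller box keeps the coordinates, so the new slices lie in old ones and both
leaf conditions are inherited. Equality of the underlying maps is recorded so that chart derivatives
can be compared. -/
theorem IsDistinguished.exists_restr (hφ : IsDistinguished r leaf dim k φ) {x : M}
    (hx : x ∈ φ.source) {O : Set M} (hO : IsOpen O) (hxO : x ∈ O) :
    ∃ φ' : OpenPartialHomeomorph M (Eu n), IsDistinguished r leaf dim k φ' ∧ x ∈ φ'.source ∧
      φ'.source ⊆ φ.source ∩ O ∧ (φ' : M → Eu n) = φ := by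
  have hz := φ.map_source hx
  have hzO : φ.symm (φ x) ∈ O := by rwa [φ.left_inv hx]
  obtain ⟨a, b, hab, hsub⟩ := exists_boxSet_subset (inter_mem (φ.open_target.mem_nhds hz)
    ((φ.continuousAt_symm hz).preimage_mem_nhds (hO.mem_nhds hzO)))
  have hs : IsOpen (φ.source ∩ φ ⁻¹' boxSet a b) := φ.isOpen_inter_preimage (isOpen_boxSet a b)
  have hsrc : (φ.restr (φ.source ∩ φ ⁻¹' boxSet a b)).source = φ.source ∩ φ ⁻¹' boxSet a b := by
    rw [φ.restr_source, hs.interior_eq, ← inter_assoc, inter_self]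
  refine ⟨φ.restr (φ.source ∩ φ ⁻¹' boxSet a b), ⟨?_, ⟨a, b, ?_⟩, ?_, ?_⟩, ?_, ?_, rfl⟩
  · exact restr_mem_maximalAtlas _ hφ.mem_atlas hs
  · change φ.target ∩ φ.symm ⁻¹' interior (φ.source ∩ φ ⁻¹' boxSet a b) = boxSet a b
    rw [hs.interior_eq]
    ext z
    constructor
    · rintro ⟨h1, h2, h3⟩
      rwa [mem_preimage, φ.right_inv h1] at h3
    · intro h
      have h1 := (hsub h).1
      refine ⟨h1, φ.map_target h1, ?_⟩
      rwa [mem_preimage, φ.right_inv h1]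
  · intro y hy z hz h
    rw [hsrc] at hy hz
    exact hφ.slice y hy.1 z hz.1 h
  · intro y hy hd
    rw [hsrc] at hy
    refine (hφ.countable y hy.1 hd).mono (image_mono fun z hz => ?_)
    rw [hsrc] at hz
    exact ⟨hz.1.1, hz.2⟩
  · rw [hsrc]; exact ⟨hx, hab⟩
  · rw [hsrc]
    intro y hy
    refine ⟨hy.1, ?_⟩
    have := (hsub hy.2).2
    rwa [mem_preimage, φ.left_inv hy.1] at this

theorem IsDistinguished.mdifferentiable [IsManifold 𝓘(ℝ, Eu n) ω M]
    (hφ : IsDistinguished r leaf dim k φ) (hr0 : r ≠ 0) :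
    φ.MDifferentiable 𝓘(ℝ, Eu n) 𝓘(ℝ, Eu n) := by
  have : IsManifold 𝓘(ℝ, Eu n) r M := IsManifold.of_le (n := ω) le_top
  exact mdifferentiable_of_mem_maximalAtlas hr0 hφ.mem_atlas

/-- A slice of codimension one is contained in a single slice of any distinguished chart whose
dimension is that of the leaf. -/
theorem transverse_const_on_slice {k' : ℕ} (hφ : IsDistinguished r leaf dim k φ)
    (hψ : IsDistinguished r leaf dim k' ψ) {i₀ : Fin n} (hi₀ : i₀.val + 1 = n) (hk : k + 1 = n)
    (hsub : φ.source ⊆ ψ.source) {y z : M} (hy : y ∈ φ.source) (hz : z ∈ φ.source)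
    (hd : dim y = k') (hyz : φ y i₀ = φ z i₀) : transverse k' ψ y = transverse k' ψ z := by
  have hpre := isPreconnected_slice hφ.box i₀ (φ z i₀)
  have himg := hpre.image _ ((continuousOn_transverse k' ψ).mono (inter_subset_left.trans hsub))
  -- The slice is connected and lies in one leaf, so its transverse image is a connected subset of a
  -- countable set. Countable sets are totally disconnected here, hence the image is a single point.
  refine (hψ.countable y (hsub hy) hd).isTotallyDisconnected _ ?_ himg ⟨y, ⟨hy, hyz⟩, rfl⟩
    ⟨z, ⟨hz, rfl⟩, rfl⟩
  refine image_mono fun p hp => ⟨hsub hp.1, ?_⟩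
  exact hφ.slice y hy p hp.1 ((transverse_eq_iff φ hi₀ hk).2 (hyz.trans hp.2.symm))

/-- If a function is constant on the slices of codimension one, then its differential is
proportional to that of the transverse coordinate. -/
theorem diffAt_of_const_on_slices
    (hd : φ.MDifferentiable 𝓘(ℝ, Eu n) 𝓘(ℝ, Eu n)) {i₀ : Fin n} {f : M → ℝ} {x : M}
    (hx : x ∈ φ.source) (hf : MDifferentiableAt 𝓘(ℝ, Eu n) 𝓘(ℝ, ℝ) f x)
    (hconst : ∀ z ∈ φ.source, φ x i₀ = φ z i₀ → f x = f z) {v : Eu n}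
    (hv : chartDeriv φ x v i₀ = 0) : diffAt f x v = 0 := by
  have hz := φ.map_source hx
  have h1 := hasFDerivAt_comp_symm hd hz (f := f) (by rwa [φ.left_inv hx])
  have h2 : HasDerivAt (fun t : ℝ => φ x + t • chartDeriv φ x v) (chartDeriv φ x v) 0 := by
    simpa using ((hasDerivAt_id (0 : ℝ)).smul_const (chartDeriv φ x v)).const_add (φ x)
  have h3 := HasFDerivAt.comp_hasDerivAt (l := fun z => f (φ.symm z)) (0 : ℝ)
    (f := fun t : ℝ => φ x + t • chartDeriv φ x v) (by simpa using h1) h2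
  have h4 : (fun z => f (φ.symm z)) ∘ (fun t : ℝ => φ x + t • chartDeriv φ x v)
      =ᶠ[𝓝 0] fun _ => f x := by
    have : ∀ᶠ t in 𝓝 (0 : ℝ), φ x + t • chartDeriv φ x v ∈ φ.target :=
      h2.continuousAt.eventually_mem (φ.open_target.mem_nhds (by simpa using hz))
    filter_upwards [this] with t ht
    refine (hconst _ (φ.map_target ht) ?_).symm
    rw [φ.right_inv ht]
    simp [hv]
  have h5 := h3.unique ((hasDerivAt_const (0 : ℝ) (f x)).congr_of_eventuallyEq h4)
  rwa [φ.left_inv hx, ContinuousLinearMap.comp_apply, chartSymmDeriv_chartDeriv hd hx] at h5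

/-- If `df` kills the vectors tangent to the slices of codimension one, then `f` is constant on
the slices. -/
theorem const_on_slices_of_diffAt
    (hd : φ.MDifferentiable 𝓘(ℝ, Eu n) 𝓘(ℝ, Eu n))
    (hbox : ∃ a b : Fin n → ℝ, φ.target = {z | ∀ i, z i ∈ Ioo (a i) (b i)})
    {i₀ : Fin n} {f : M → ℝ} (hf : ∀ x ∈ φ.source, MDifferentiableAt 𝓘(ℝ, Eu n) 𝓘(ℝ, ℝ) f x)
    (hdf : ∀ x ∈ φ.source, ∀ v : Eu n, chartDeriv φ x v i₀ = 0 → diffAt f x v = 0)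
    {y z : M} (hy : y ∈ φ.source) (hz : z ∈ φ.source) (hyz : φ y i₀ = φ z i₀) : f y = f z := by
  obtain ⟨a, b, hab⟩ := hbox
  have hconv : Convex ℝ φ.target := by rw [hab]; exact convex_boxSet a b
  have hmem : ∀ t ∈ Icc (0 : ℝ) 1, φ y + t • (φ z - φ y) ∈ φ.target := fun t ht =>
    hconv.add_smul_sub_mem (φ.map_source hy) (φ.map_source hz) ht
  have hder : ∀ t ∈ Icc (0 : ℝ) 1,
      HasDerivWithinAt (fun t : ℝ => f (φ.symm (φ y + t • (φ z - φ y)))) 0 (Icc 0 1) t := by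
    intro t ht
    have hp := φ.map_target (hmem t ht)
    have h1 := hasFDerivAt_comp_symm hd (hmem t ht) (hf _ hp)
    have h2 : HasDerivAt (fun t : ℝ => φ y + t • (φ z - φ y)) (φ z - φ y) t := by
      simpa using ((hasDerivAt_id t).smul_const (φ z - φ y)).const_add (φ y)
    have h3 := h1.comp_hasDerivAt t h2
    have h4 : (diffAt f (φ.symm (φ y + t • (φ z - φ y))) ∘L
        chartSymmDeriv φ (φ y + t • (φ z - φ y))) (φ z - φ y) = 0 := by
      rw [ContinuousLinearMap.comp_apply]
      refine hdf _ hp _ ?_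
      rw [chartDeriv_chartSymmDeriv hd (hmem t ht)]
      simp [hyz]
    rw [h4] at h3
    exact h3.hasDerivWithinAt
  have h := (convex_Icc (0 : ℝ) 1).norm_image_sub_le_of_norm_hasDerivWithin_le (C := 0) hder
    (by simp) (left_mem_Icc.2 zero_le_one) (right_mem_Icc.2 zero_le_one)
  simp [φ.left_inv hy, φ.left_inv hz, sub_eq_zero] at h
  exact h.symm

end Distinguished

/-! ### Constancy of the leaf dimension in a chart of codimension one -/

section Dimension

variable {n : ℕ} {r : WithTop ℕ∞} {M : Type*} [TopologicalSpace M] [ChartedSpace (Eu n) M]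
  [IsManifold 𝓘(ℝ, Eu n) ω M] (𝓕 : SingularFoliation n r M)

/-- All leaves through the domain of a distinguished chart of codimension one have codimension
one. -/
theorem dim_eq_of_isDistinguished (hr0 : r ≠ 0) (hcodim : 𝓕.IsCodimOne) {k : ℕ} (hk : k + 1 = n)
    {φ : OpenPartialHomeomorph M (Eu n)} (hφ : IsDistinguished r 𝓕.leaf 𝓕.dim k φ) {y : M}
    (hy : y ∈ φ.source) : 𝓕.dim y = k := by
  by_contra hne
  have hlt : 𝓕.dim y < k := by have := hcodim.1 y; omega
  obtain ⟨ψ, hψ, hyψ⟩ := 𝓕.exists_chart y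
  obtain ⟨φ', hφ', hyφ', hsub, -⟩ := hφ.exists_restr hy ψ.open_source hyψ
  have hdφ := hφ'.mdifferentiable hr0
  have hdψ := hψ.mdifferentiable hr0
  let i₀ : Fin n := ⟨k, by omega⟩
  let i₁ : Fin n := ⟨𝓕.dim y, by omega⟩
  have hi₀ : i₀.val + 1 = n := hk
  have hz : φ' y ∈ φ'.target := φ'.map_source hyφ'
  -- Every transverse coordinate of `ψ` is constant on the slices of `φ'`, so its differential
  -- vanishes on the hyperplane tangent to them. As `dim y < k`, the indices `i₀` and `i₁` give two
  -- such coordinates, whose independent differentials cannot both be multiples of one form.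
  have hproj : ∀ i : Fin n, 𝓕.dim y ≤ i.val → ∀ v : Eu n, chartDeriv φ' y v i₀ = 0 →
      chartDeriv ψ y v i = 0 := by
    intro i hi v hv
    have h1 : HasMFDerivAt 𝓘(ℝ, Eu n) 𝓘(ℝ, Eu n) ψ y (chartDeriv ψ y) :=
      (hdψ.mdifferentiableAt hyψ).hasMFDerivAt
    have h2 : HasMFDerivAt 𝓘(ℝ, Eu n) 𝓘(ℝ, ℝ) (fun p => ψ p i) y
        ((EuclideanSpace.proj i : Eu n →L[ℝ] ℝ) ∘L chartDeriv ψ y) :=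
      (EuclideanSpace.proj i : Eu n →L[ℝ] ℝ).hasMFDerivAt.comp y h1
    have h3 := diffAt_of_const_on_slices hdφ (i₀ := i₀) hyφ' h2.mdifferentiableAt (fun z hz hyz =>
      congrFun (transverse_const_on_slice hφ' hψ hi₀ hk (hsub.trans inter_subset_right) hyφ' hz rfl
        hyz) ⟨i, hi⟩) hv
    rw [diffAt, diff, h2.mfderiv] at h3
    exact h3
  have hsurj : ∀ w : Eu n, ∃ v, chartDeriv ψ y v = w := fun w =>
    ⟨chartSymmDeriv ψ (ψ y) w, by
      have := chartDeriv_chartSymmDeriv hdψ (ψ.map_source hyψ) w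
      rwa [ψ.left_inv hyψ] at this⟩
  obtain ⟨v, hv⟩ := hsurj (EuclideanSpace.single i₀ 1)
  obtain ⟨w, hw⟩ := hsurj (EuclideanSpace.single i₁ 1)
  have hne' : i₀ ≠ i₁ := fun h => hlt.ne' (Fin.ext_iff.1 h)
  -- The combination of `v` and `w` is chosen to be tangent to the slice of `φ'`. Its
  -- `i₁`-coordinate in `ψ` then forces `v` itself to be tangent, contradicting that its
  -- `i₀`-coordinate in `ψ` is `1`.
  have hu : chartDeriv φ' y (chartDeriv φ' y w i₀ • v - chartDeriv φ' y v i₀ • w) i₀ = 0 := by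
    simp; ring
  have h0 := hproj i₀ hlt.le _ hu
  have h1 := hproj i₁ le_rfl _ hu
  simp [hv, hw, hne', hne'.symm] at h0 h1
  have h2 := hproj i₀ hlt.le v h1
  simp [hv] at h2

end Dimension

/-! ### Defining functions and the Riemannian condition -/

section Defining

variable {n : ℕ} {r : WithTop ℕ∞} {M : Type*} [TopologicalSpace M] [ChartedSpace (Eu n) M]
  {𝓕 : SingularFoliation n r M} {U : Set M} {f : M → ℝ}

theorem SingularFoliation.IsDefiningOn.mdifferentiableAt (hf : 𝓕.IsDefiningOn U f) (hr0 : r ≠ 0)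
    (hU : IsOpen U) {x : M} (hx : x ∈ U) : MDifferentiableAt 𝓘(ℝ, Eu n) 𝓘(ℝ, ℝ) f x :=
  (hf.contMDiffOn.contMDiffAt (hU.mem_nhds hx)).mdifferentiableAt hr0

theorem leafIn_of_slice (hreg : U ⊆ 𝓕.regular) {k : ℕ} {i₀ : Fin n} (hi₀ : i₀.val + 1 = n)
    (hk : k + 1 = n) {φ : OpenPartialHomeomorph M (Eu n)}
    (hφ : IsDistinguished r 𝓕.leaf 𝓕.dim k φ) (hsub : φ.source ⊆ U) {y z : M} (hy : y ∈ φ.source)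
    (hz : z ∈ φ.source) (hyz : φ y i₀ = φ z i₀) : 𝓕.leafIn U y z := by
  have hd : 𝓕.dim y = k := by have : 𝓕.dim y + 1 = n := hreg (hsub hy); omega
  subst hd
  exact Relation.EqvGen.rel _ _ ⟨φ, hφ, hsub, hy, hz, (transverse_eq_iff φ hi₀ hk).2 hyz⟩

/-- Leaves of the restriction to `U` are generated by chains of plaques inside `U`, so invariance
along each plaque propagates along the chain. -/
theorem eq_of_leafIn_of_slice {F : M → ℝ} (hreg : U ⊆ 𝓕.regular)
    (hF : ∀ (k : ℕ) (i₀ : Fin n) (φ : OpenPartialHomeomorph M (Eu n)), i₀.val + 1 = n → k + 1 = n →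
      IsDistinguished r 𝓕.leaf 𝓕.dim k φ → φ.source ⊆ U → ∀ y ∈ φ.source, ∀ z ∈ φ.source,
      φ y i₀ = φ z i₀ → F y = F z) {y z : M} (h : 𝓕.leafIn U y z) : F y = F z := by
  induction h with
  | rel y z h =>
    obtain ⟨φ, hφ, hsub, hy, hz, htr⟩ := h
    have hk : 𝓕.dim y + 1 = n := hreg (hsub hy)
    exact hF _ ⟨𝓕.dim y, by omega⟩ φ hk hk hφ hsub y hy z hz ((transverse_eq_iff φ hk hk).1 htr)
  | refl _ => rfl
  | symm _ _ _ ih => exact ih.symm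
  | trans _ _ _ _ _ ih₁ ih₂ => exact ih₁.trans ih₂

theorem SingularFoliation.IsDefiningOn.eq_of_leafIn (hf : 𝓕.IsDefiningOn U f) {y z : M}
    (hy : y ∈ U) (hz : z ∈ U) (h : 𝓕.leafIn U y z) : f y = f z :=
  ((connectedComponentIn_subset _ _ ((hf.represents y hy z hz).1 h)).2 : f z = f y).symm

theorem SingularFoliation.IsDefiningOn.eq_of_slice (hf : 𝓕.IsDefiningOn U f)
    (hreg : U ⊆ 𝓕.regular) {k : ℕ} {i₀ : Fin n} (hi₀ : i₀.val + 1 = n)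
    (hk : k + 1 = n) {φ : OpenPartialHomeomorph M (Eu n)}
    (hφ : IsDistinguished r 𝓕.leaf 𝓕.dim k φ) (hsub : φ.source ⊆ U) {y z : M} (hy : y ∈ φ.source)
    (hz : z ∈ φ.source) (hyz : φ y i₀ = φ z i₀) : f y = f z :=
  hf.eq_of_leafIn (hsub hy) (hsub hz) (leafIn_of_slice hreg hi₀ hk hφ hsub hy hz hyz)

variable [IsManifold 𝓘(ℝ, Eu n) ω M]

/-- The kernel of the differential of a defining function, in a distinguished chart. -/
theorem SingularFoliation.IsDefiningOn.diffAt_eq_zero_iff (hf : 𝓕.IsDefiningOn U f) (hr0 : r ≠ 0)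
    (hU : IsOpen U) (hreg : U ⊆ 𝓕.regular) {k : ℕ} {i₀ : Fin n} (hi₀ : i₀.val + 1 = n)
    (hk : k + 1 = n) {φ : OpenPartialHomeomorph M (Eu n)}
    (hφ : IsDistinguished r 𝓕.leaf 𝓕.dim k φ) {x : M} (hx : x ∈ φ.source) (hxU : x ∈ U) (v : Eu n) :
    diffAt f x v = 0 ↔ chartDeriv φ x v i₀ = 0 := by
  have hker : ∀ w : Eu n, chartDeriv φ x w i₀ = 0 → diffAt f x w = 0 := by
    intro w hw
    obtain ⟨φ', hφ', hxφ', hsub, hcoe⟩ := hφ.exists_restr hx hU hxU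
    refine diffAt_of_const_on_slices (hφ'.mdifferentiable hr0) hxφ' (hf.mdifferentiableAt hr0 hU hxU)
      (fun z hz hxz => hf.eq_of_slice hreg hi₀ hk hφ' (hsub.trans inter_subset_right) hxφ' hz hxz) ?_
    rwa [chartDeriv, hcoe]
  refine ⟨fun h => ?_, hker v⟩
  by_contra hne
  refine hf.diff_ne_zero x hxU (show diffAt f x = 0 from ContinuousLinearMap.ext fun w => ?_)
  -- If `v` were transverse and killed by `df`, then subtracting a multiple of `v` would make any
  -- `w` tangent to the slice, so `df` would vanish entirely.
  have h1 := hker (w - (chartDeriv φ x w i₀ / chartDeriv φ x v i₀) • v) (by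
    simp [div_mul_cancel₀ _ hne])
  rw [map_sub, map_smul, h, smul_zero, sub_zero] at h1
  exact h1

theorem SingularFoliation.IsDefiningOn.isTangent_iff (hf : 𝓕.IsDefiningOn U f) (hr0 : r ≠ 0)
    (hU : IsOpen U) (hreg : U ⊆ 𝓕.regular) {x : M} (hxU : x ∈ U)
    (v : TangentSpace 𝓘(ℝ, Eu n) x) : 𝓕.IsTangent x v ↔ diff f x v = 0 := by
  have hk : 𝓕.dim x + 1 = n := hreg hxU
  have hi₀ : (⟨𝓕.dim x, by omega⟩ : Fin n).val + 1 = n := hk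
  constructor
  · rintro ⟨φ, hφ, hx, h⟩
    exact (hf.diffAt_eq_zero_iff hr0 hU hreg hi₀ hk hφ hx hxU v).2 (h _ le_rfl)
  · intro h
    obtain ⟨φ, hφ, hx⟩ := 𝓕.exists_chart x
    refine ⟨φ, hφ, hx, fun i hi => ?_⟩
    have hi' : i.val + 1 = n := by have := i.isLt; omega
    exact (hf.diffAt_eq_zero_iff hr0 hU hreg hi' hk hφ hx hxU v).1 h

variable (g : Metric n M)

theorem SingularFoliation.IsDefiningOn.isNormal_grad (hf : 𝓕.IsDefiningOn U f) (hr0 : r ≠ 0)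
    (hU : IsOpen U) (hreg : U ⊆ 𝓕.regular) {x : M} (hxU : x ∈ U) :
    𝓕.IsNormal g x (grad g f x) := fun v hv => by
  rw [inner_grad]
  exact (hf.isTangent_iff hr0 hU hreg hxU v).1 hv

/-- If the foliation is Riemannian, then `|∇f|²` is stationary along the leaves, for every
defining function `f`. -/
theorem SingularFoliation.IsDefiningOn.diffAt_gradSq_eq_zero (hf : 𝓕.IsDefiningOn U f)
    (hr1 : r + 1 ≤ r) (hr2 : 2 ≤ r) (hU : IsOpen U) (hreg : U ⊆ 𝓕.regular)
    (hriem : 𝓕.IsRiemannian g) {x : M} (hxU : x ∈ U) {w : Eu n} (hw : diffAt f x w = 0) :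
    diffAt (gradSq g f) x w = 0 := by
  have hr0 : r ≠ 0 := by rintro rfl; simp at hr2
  have hψ : chartAt (Eu n) x ∈ IsManifold.maximalAtlas 𝓘(ℝ, Eu n) ω M :=
    IsManifold.chart_mem_maximalAtlas x
  have hxs : x ∈ (chartAt (Eu n) x).source := mem_chart_source _ x
  generalize chartAt (Eu n) x = ψ at hψ hxs
  have hd := mdifferentiable_of_analytic hψ
  have hfd : ∀ {y : M}, y ∈ U → MDifferentiableAt 𝓘(ℝ, Eu n) 𝓘(ℝ, ℝ) f y :=
    fun hy => hf.mdifferentiableAt hr0 hU hy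
  -- Geodesics are confined to the part of the chart lying over `U`, where normality to the leaves
  -- can be read off from `df`.
  set s : Set (Eu n) := ψ.target ∩ ψ.symm ⁻¹' U with hs_def
  have hs : IsOpen s := ψ.isOpen_inter_preimage_symm hU
  have hz : ψ x ∈ ψ.target := ψ.map_source hxs
  have hzx : ψ.symm (ψ x) = x := ψ.left_inv hxs
  have hzs : ψ x ∈ s := ⟨hz, by rwa [mem_preimage, hzx]⟩
  have hG : ContDiffOn ℝ ω (metricForm g ψ) ψ.target := contDiffOn_metricForm g hψ
  obtain ⟨c, ε, hε, hc0, hc1, hc⟩ := exists_coord_geodesic hs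
    ((hG.of_le (m := 2) le_top).mono inter_subset_left)
    (fun z hz => metricForm_isInvertible g hd hz.1) hzs (fieldInChart ψ (grad g f) (ψ x))
  have h0 : (0 : ℝ) ∈ Ioo (-ε) ε := ⟨by linarith, hε⟩
  have hGd : ∀ t ∈ Ioo (-ε) ε, ∀ u v w : Eu n,
      fderiv ℝ (fun z => metricInChart g ψ z u v) (c t) w
        = fderiv ℝ (metricForm g ψ) (c t) w u v := by
    intro t ht u v w
    have h1 : HasFDerivAt (metricForm g ψ) (fderiv ℝ (metricForm g ψ) (c t)) (c t) :=
      ((hG.contDiffAt (ψ.open_target.mem_nhds (hc t ht).1.1)).differentiableAt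
        (by simp)).hasFDerivAt
    have h2 := (h1.clm_apply (hasFDerivAt_const u (c t))).clm_apply (hasFDerivAt_const v (c t))
    have h3 : HasFDerivAt (fun z => metricInChart g ψ z u v) _ (c t) := h2
    rw [h3.fderiv]
    simp
  have hvel : ∀ t ∈ Ioo (-ε) ε,
      (velocity (fun τ => ψ.symm (c τ)) t : Eu n) = chartSymmDeriv ψ (c t) (deriv c t) := by
    intro t ht
    have h1 : HasMFDerivAt 𝓘(ℝ, Eu n) 𝓘(ℝ, Eu n) ψ.symm (c t) (chartSymmDeriv ψ (c t)) :=
      (hd.mdifferentiableAt_symm (hc t ht).1.1).hasMFDerivAt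
    have h2 : HasFDerivAt c (fderiv ℝ c t) t :=
      ((hc t ht).2.1.differentiableAt (by norm_num)).hasFDerivAt
    have h3 := h1.comp t h2.hasMFDerivAt
    have h4 : mfderiv 𝓘(ℝ, ℝ) 𝓘(ℝ, Eu n) (fun τ => ψ.symm (c τ)) t
      = chartSymmDeriv ψ (c t) ∘L fderiv ℝ c t := h3.mfderiv
    rw [velocity, h4]
    rfl
  have hgeo : IsGeodesicOn g (fun τ => ψ.symm (c τ)) (Ioo (-ε) ε) := by
    intro t ht
    obtain ⟨hcs, hc2, heq⟩ := hc t ht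
    have hev : (fun τ => ψ (ψ.symm (c τ))) =ᶠ[𝓝 t] c := by
      filter_upwards [isOpen_Ioo.mem_nhds ht] with τ hτ
      exact ψ.right_inv (hc τ hτ).1.1
    refine ⟨(ψ.continuousAt_symm hcs.1).comp hc2.continuousAt, ψ, hψ, ψ.map_target hcs.1,
      hc2.congr_of_eventuallyEq hev, fun u => ?_⟩
    rw [hev.deriv.deriv_eq, hev.deriv_eq, hev.self_of_nhds, hGd t ht, hGd t ht]
    exact heq u
  have hnor0 : 𝓕.IsNormal g (ψ.symm (c 0)) (velocity (fun τ => ψ.symm (c τ)) 0) := by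
    have h1 : (velocity (fun τ => ψ.symm (c τ)) 0 : Eu n) = grad g f (ψ.symm (c 0)) := by
      rw [hvel 0 h0, hc1, ← hc0]
      exact chartSymmDeriv_fieldInChart hd (hc 0 h0).1.1 _
    intro v hv
    have h2 := hf.isNormal_grad g hr0 hU hreg (hc 0 h0).1.2 v hv
    exact (congrArg (fun q : Eu n => innerAt g (ψ.symm (c 0)) q v) h1).trans h2
  have hnor : ∀ᶠ t in 𝓝 (0 : ℝ), ∀ u, fderiv ℝ (fun y => f (ψ.symm y)) (c t) u = 0 →
      metricForm g ψ (c t) (deriv c t) u = 0 := by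
    filter_upwards [isOpen_Ioo.mem_nhds h0] with t ht u hu
    -- The Riemannian hypothesis enters here: the geodesic starts in the direction of `∇f`, hence
    -- remains normal to the leaves.
    have h1 := hriem _ (-ε) ε hgeo 0 h0 t ht hnor0
    rw [(hasFDerivAt_comp_symm hd (hc t ht).1.1 (hfd (hc t ht).1.2)).fderiv] at hu
    have h2 := h1 (chartSymmDeriv ψ (c t) u)
      ((hf.isTangent_iff hr0 hU hreg (hc t ht).1.2 _).2 hu)
    rw [metricForm_apply]
    exact (congrArg (fun q : Eu n => innerAt g (ψ.symm (c t)) q (chartSymmDeriv ψ (c t) u))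
      (hvel t ht)).symm.trans h2
  have hUev : ∀ᶠ z in 𝓝 (ψ x), z ∈ s := hs.mem_nhds hzs
  have hrM : IsManifold 𝓘(ℝ, Eu n) r M := IsManifold.of_le (n := ω) le_top
  have hf2 : ContDiffAt ℝ 2 (fun y => f (ψ.symm y)) (ψ x) :=
    (contDiffAt_comp_symm (IsManifold.maximalAtlas_subset_of_le le_top hψ) hz
      (hf.contMDiffOn.contMDiffAt (hU.mem_nhds hzs.2))).of_le hr2
  have hlen : fderiv ℝ (fun y => f (ψ.symm y)) (ψ x) (fieldInChart ψ (grad g f) (ψ x)) ≠ 0 := by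
    rw [← gradSq_comp_symm g hd hz (hfd hzs.2)]
    exact (gradSq_pos g (hf.diff_ne_zero _ hzs.2)).ne'
  have hgeo0 := (hc 0 h0).2.2
  have hS := hasFDerivAt_comp_symm hd hz (f := gradSq g f)
    (((contMDiffOn_gradSq g hr1 hr0 hU hf.contMDiffOn).contMDiffAt
      (hU.mem_nhds hzs.2)).mdifferentiableAt hr0)
  have hSeq : (fun y => gradSq g f (ψ.symm y)) =ᶠ[𝓝 (ψ x)]
      fun z => fderiv ℝ (fun y => f (ψ.symm y)) z (fieldInChart ψ (grad g f) z) :=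
    hUev.mono fun z hz => gradSq_comp_symm g hd hz.1 (hfd hz.2)
  have key := fderiv_coord_gradSq_eq_zero (G := metricForm g ψ) (f := fun y => f (ψ.symm y))
    (W := fieldInChart ψ (grad g f)) (z₀ := ψ x)
    ((hG.contDiffAt (ψ.open_target.mem_nhds hz)).differentiableAt (by simp)) hf2
    ((contDiffAt_fieldInChart_grad g hψ hr1 hr0 hU hf.contMDiffOn hz hzs.2).differentiableAt hr0)
    (metricForm_symm g ψ (ψ x))
    (hUev.mono fun z hz u => metricForm_grad g hd hz.1 (hfd hz.2) u) hlen (hc 0 h0).2.1 hc0 hc1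
    hgeo0 hnor (w := chartDeriv ψ x w) (by
      rw [(hasFDerivAt_comp_symm hd hz (hfd hzs.2)).fderiv, ContinuousLinearMap.comp_apply,
        chartSymmDeriv_chartDeriv hd hxs, hzx, hw])
  rw [← hSeq.fderiv_eq, hS.fderiv, ContinuousLinearMap.comp_apply,
    chartSymmDeriv_chartDeriv hd hxs, hzx] at key
  exact key

end Defining

/-! ### Functions of the transverse coordinate -/

/-- A function of one variable without critical points on an interval has an inverse of the same
class. -/
theorem exists_contDiffOn_inverse {h : ℝ → ℝ} {a b : ℝ} {k : WithTop ℕ∞} (hk : k ≠ 0)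
    (hh : ContDiffOn ℝ k h (Ioo a b)) (hd : ∀ s ∈ Ioo a b, deriv h s ≠ 0) :
    ∃ q : ℝ → ℝ, ContDiffOn ℝ k q (h '' Ioo a b) ∧ ∀ s ∈ Ioo a b, q (h s) = s := by
  -- By Rolle's theorem, equal values at two points would produce a critical point between them.
  have hlt : ∀ s ∈ Ioo a b, ∀ t ∈ Ioo a b, s < t → h s ≠ h t := by
    intro s hs t ht hst heq
    have hsub : Icc s t ⊆ Ioo a b := (ordConnected_Ioo).out hs ht
    obtain ⟨c, hc, hc0⟩ := exists_deriv_eq_zero hst (hh.continuousOn.mono hsub) heq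
    exact hd c (hsub (Ioo_subset_Icc_self hc)) hc0
  have hinj : InjOn h (Ioo a b) := by
    intro s hs t ht heq
    rcases lt_trichotomy s t with hst | hst | hst
    · exact absurd heq (hlt s hs t ht hst)
    · exact hst
    · exact absurd heq.symm (hlt t ht s hs hst)
  have hleft : ∀ s ∈ Ioo a b, Function.invFunOn h (Ioo a b) (h s) = s := hinj.leftInvOn_invFunOn
  refine ⟨Function.invFunOn h (Ioo a b), ?_, hleft⟩
  rintro _ ⟨s, hs, rfl⟩
  refine ContDiffAt.contDiffWithinAt ?_
  have hc : ContDiffAt ℝ k h s := hh.contDiffAt (isOpen_Ioo.mem_nhds hs)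
  have hder := (hc.differentiableAt hk).hasDerivAt.hasFDerivAt_equiv (hd s hs)
  have hloc := hc.to_localInverse hder hk
  let P := hc.toOpenPartialHomeomorph h hder hk
  have hPs : s ∈ P.source := hc.mem_toOpenPartialHomeomorph_source hder hk
  have hPt : h s ∈ P.target := hc.image_mem_toOpenPartialHomeomorph_target hder hk
  have hsymm : P.symm (h s) = s := P.left_inv hPs
  -- The global inverse coincides near `h s` with the one from the inverse function theorem: the
  -- latter takes values in the interval there, on which `h` is injective.
  refine hloc.congr_of_eventuallyEq ?_
  have hmem : ∀ᶠ y in 𝓝 (h s), P.symm y ∈ Ioo a b :=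
    (P.continuousAt_symm hPt).eventually_mem (by rw [hsymm]; exact isOpen_Ioo.mem_nhds hs)
  filter_upwards [hmem, P.open_target.mem_nhds hPt] with y hy hyt
  have hhy : h (P.symm y) = y := P.right_inv hyt
  have h1 := hleft _ hy
  rw [hhy] at h1
  exact h1

section Profile

variable {n : ℕ} {M : Type*} [TopologicalSpace M]
  {φ : OpenPartialHomeomorph M (Eu n)} {f : M → ℝ}

/-- The line through `p` in the direction of the coordinate `i₀`, parametrized by that
coordinate. -/
def transversal (i₀ : Fin n) (p : Eu n) (s : ℝ) : Eu n := p + (s - p i₀) • EuclideanSpace.single i₀ 1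

theorem transversal_self (i₀ : Fin n) (p : Eu n) (s : ℝ) : transversal i₀ p s i₀ = s := by
  simp [transversal]

theorem transversal_mem {a b : Fin n → ℝ} (hab : φ.target = {z | ∀ i, z i ∈ Ioo (a i) (b i)})
    {i₀ : Fin n} {p : Eu n} (hp : p ∈ φ.target) {s : ℝ} (hs : s ∈ Ioo (a i₀) (b i₀)) :
    transversal i₀ p s ∈ φ.target := by
  rw [hab] at hp ⊢
  intro i
  by_cases h : i = i₀
  · subst h; rwa [transversal_self]
  · simpa [transversal, h] using hp i

theorem coord_mem {a b : Fin n → ℝ} (hab : φ.target = {z | ∀ i, z i ∈ Ioo (a i) (b i)})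
    (i₀ : Fin n) {x : M} (hx : x ∈ φ.source) : φ x i₀ ∈ Ioo (a i₀) (b i₀) := by
  have := φ.map_source hx
  rw [hab] at this
  exact this i₀

/-- The restriction of a function to a transversal of the slices of a chart. -/
def profile (φ : OpenPartialHomeomorph M (Eu n)) (i₀ : Fin n) (p : Eu n) (f : M → ℝ) (s : ℝ) : ℝ :=
  f (φ.symm (transversal i₀ p s))

theorem eq_profile {a b : Fin n → ℝ} (hab : φ.target = {z | ∀ i, z i ∈ Ioo (a i) (b i)})
    {i₀ : Fin n} {p : Eu n} (hp : p ∈ φ.target)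
    (hf : ∀ y ∈ φ.source, ∀ z ∈ φ.source, φ y i₀ = φ z i₀ → f y = f z) {x : M}
    (hx : x ∈ φ.source) : f x = profile φ i₀ p f (φ x i₀) := by
  have hs := transversal_mem hab hp (coord_mem hab i₀ hx)
  refine hf _ hx _ (φ.map_target hs) ?_
  rw [φ.right_inv hs, transversal_self]

variable [ChartedSpace (Eu n) M] [IsManifold 𝓘(ℝ, Eu n) ω M] {k : WithTop ℕ∞}

theorem contDiffOn_profile (hφ : φ ∈ IsManifold.maximalAtlas 𝓘(ℝ, Eu n) k M) {a b : Fin n → ℝ}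
    (hab : φ.target = {z | ∀ i, z i ∈ Ioo (a i) (b i)}) {i₀ : Fin n} {p : Eu n} (hp : p ∈ φ.target)
    (hf : ContMDiffOn 𝓘(ℝ, Eu n) 𝓘(ℝ, ℝ) k f φ.source) :
    ContDiffOn ℝ k (profile φ i₀ p f) (Ioo (a i₀) (b i₀)) := by
  have : IsManifold 𝓘(ℝ, Eu n) k M := IsManifold.of_le (n := ω) le_top
  intro s hs
  have hmem := transversal_mem hab hp hs
  have h1 := contDiffAt_comp_symm hφ hmem
    (hf.contMDiffAt (φ.open_source.mem_nhds (φ.map_target hmem)))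
  have h2 : ContDiffAt ℝ k (transversal i₀ p) s :=
    contDiffAt_const.add ((contDiffAt_id.sub contDiffAt_const).smul contDiffAt_const)
  exact (h1.comp s h2).contDiffWithinAt

/-- This is the chain rule for `f` as a function of one coordinate. It makes the differentials of
two such functions comparable through the ratio of their profile derivatives. -/
theorem diffAt_eq_profile (hk0 : k ≠ 0) (hφ : φ ∈ IsManifold.maximalAtlas 𝓘(ℝ, Eu n) k M)
    {a b : Fin n → ℝ} (hab : φ.target = {z | ∀ i, z i ∈ Ioo (a i) (b i)}) {i₀ : Fin n} {p : Eu n}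
    (hp : p ∈ φ.target) (hf : ContMDiffOn 𝓘(ℝ, Eu n) 𝓘(ℝ, ℝ) k f φ.source)
    (hconst : ∀ y ∈ φ.source, ∀ z ∈ φ.source, φ y i₀ = φ z i₀ → f y = f z) {x : M}
    (hx : x ∈ φ.source) (v : Eu n) :
    diffAt f x v = deriv (profile φ i₀ p f) (φ x i₀) * chartDeriv φ x v i₀ := by
  have : IsManifold 𝓘(ℝ, Eu n) k M := IsManifold.of_le (n := ω) le_top
  have hd : φ.MDifferentiable 𝓘(ℝ, Eu n) 𝓘(ℝ, Eu n) := mdifferentiable_of_mem_maximalAtlas hk0 hφ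
  have h1 : HasDerivAt (profile φ i₀ p f) (deriv (profile φ i₀ p f) (φ x i₀)) (φ x i₀) :=
    (((contDiffOn_profile hφ hab hp hf).contDiffAt
      (isOpen_Ioo.mem_nhds (coord_mem hab i₀ hx))).differentiableAt hk0).hasDerivAt
  have hz := φ.map_source hx
  have h2 : HasFDerivAt (fun z : Eu n => z i₀) (EuclideanSpace.proj i₀ : Eu n →L[ℝ] ℝ) (φ x) :=
    (EuclideanSpace.proj i₀ : Eu n →L[ℝ] ℝ).hasFDerivAt
  have h3 := (h1.comp_hasFDerivAt (φ x) h2).congr_of_eventuallyEq (f₁ := fun z => f (φ.symm z)) (by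
    filter_upwards [φ.open_target.mem_nhds hz] with z hz
    rw [eq_profile hab hp hconst (φ.map_target hz), φ.right_inv hz, Function.comp])
  have hfx : MDifferentiableAt 𝓘(ℝ, Eu n) 𝓘(ℝ, ℝ) f (φ.symm (φ x)) :=
    (hf.contMDiffAt (φ.open_source.mem_nhds (φ.map_target hz))).mdifferentiableAt hk0
  have h4 := congrArg (fun A : Eu n →L[ℝ] ℝ => A (chartDeriv φ x v))
    (h3.unique (hasFDerivAt_comp_symm hd hz hfx))
  simp only [ContinuousLinearMap.comp_apply, chartSymmDeriv_chartDeriv hd hx, φ.left_inv hx] at h4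
  exact h4.symm

end Profile

/-! ### Equilibrium and isoparametric properties -/

section Equilibrium

variable {n : ℕ} {r : WithTop ℕ∞} {M : Type*} [TopologicalSpace M] [ChartedSpace (Eu n) M]
  [IsManifold 𝓘(ℝ, Eu n) ω M] {𝓕 : SingularFoliation n r M} {U : Set M} {f : M → ℝ}
  (g : Metric n M)

/-- This supplies the unit normal field to which the constant mean curvature hypothesis is applied.
-/
theorem SingularFoliation.IsDefiningOn.isUnitNormalOn (hf : 𝓕.IsDefiningOn U f) (hr1 : r + 1 ≤ r)
    (hr0 : r ≠ 0) (hU : IsOpen U) (hreg : U ⊆ 𝓕.regular) :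
    𝓕.IsUnitNormalOn g U (fun y => (√(gradSq g f y))⁻¹ • grad g f y) where
  contMDiffOn := by
    intro x hx
    refine ContMDiffAt.contMDiffWithinAt ?_
    have hψ : chartAt (Eu n) x ∈ IsManifold.maximalAtlas 𝓘(ℝ, Eu n) ω M :=
      IsManifold.chart_mem_maximalAtlas x
    have hxs : x ∈ (chartAt (Eu n) x).source := mem_chart_source _ x
    generalize chartAt (Eu n) x = ψ at hψ hxs
    have hrM : IsManifold 𝓘(ℝ, Eu n) r M := IsManifold.of_le (n := ω) le_top
    have hz := ψ.map_source hxs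
    have hzU : ψ.symm (ψ x) ∈ U := by rwa [ψ.left_inv hxs]
    refine contMDiffAt_of_fieldInChart hψ le_top hxs ?_
    have hS := contDiffAt_comp_symm (IsManifold.maximalAtlas_subset_of_le le_top hψ) hz
      ((contMDiffOn_gradSq g hr1 hr0 hU hf.contMDiffOn).contMDiffAt (hU.mem_nhds hzU))
    have hpos := gradSq_pos g (hf.diff_ne_zero _ hzU)
    have hW := contDiffAt_fieldInChart_grad g hψ hr1 hr0 hU hf.contMDiffOn hz hzU
    refine (((hS.sqrt hpos.ne').inv (Real.sqrt_pos.2 hpos).ne').smul hW).congr_of_eventuallyEq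
      (Eventually.of_forall fun z => ?_)
    exact (chartDeriv ψ (ψ.symm z)).map_smul _ _
  unit x hx := by
    have hpos := gradSq_pos g (hf.diff_ne_zero x hx)
    have key : ∀ (c : ℝ) (w : Eu n), c ≠ 0 → innerAt g x w w = c * c →
        innerAt g x (c⁻¹ • w) (c⁻¹ • w) = 1 := by
      intro c w hc hw
      rw [map_smul, map_smul, smul_apply, smul_eq_mul, smul_eq_mul, hw]
      field_simp
    exact key _ (grad g f x) (Real.sqrt_pos.2 hpos).ne' (Real.mul_self_sqrt hpos.le).symm
  normal x hx v hv := by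
    have h1 := hf.isNormal_grad g hr0 hU hreg hx v hv
    have key : ∀ (c : ℝ) (w u : Eu n), innerAt g x w u = 0 → innerAt g x (c • w) u = 0 := by
      intro c w u hw
      rw [map_smul, smul_apply, hw, smul_zero]
    exact key _ (grad g f x) v h1

variable {k : ℕ} {i₀ : Fin n} {φ : OpenPartialHomeomorph M (Eu n)}

theorem SingularFoliation.IsDefiningOn.gradSq_eq_of_slice (hf : 𝓕.IsDefiningOn U f)
    (hr1 : r + 1 ≤ r) (hr2 : 2 ≤ r) (hU : IsOpen U) (hreg : U ⊆ 𝓕.regular)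
    (hriem : 𝓕.IsRiemannian g) (hi₀ : i₀.val + 1 = n) (hk : k + 1 = n)
    (hφ : IsDistinguished r 𝓕.leaf 𝓕.dim k φ) (hsub : φ.source ⊆ U) {y z : M} (hy : y ∈ φ.source)
    (hz : z ∈ φ.source) (hyz : φ y i₀ = φ z i₀) : gradSq g f y = gradSq g f z := by
  have hr0 : r ≠ 0 := by rintro rfl; simp at hr2
  refine const_on_slices_of_diffAt (hφ.mdifferentiable hr0) hφ.box (fun x hx => ?_)
    (fun x hx v hv => ?_) hy hz hyz
  · exact ((contMDiffOn_gradSq g hr1 hr0 hU hf.contMDiffOn).contMDiffAt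
      (hU.mem_nhds (hsub hx))).mdifferentiableAt hr0
  · exact hf.diffAt_gradSq_eq_zero g hr1 hr2 hU hreg hriem (hsub hx)
      ((hf.diffAt_eq_zero_iff hr0 hU hreg hi₀ hk hφ hx (hsub hx) v).2 hv)

theorem SingularFoliation.IsDefiningOn.deriv_profile_ne_zero (hf : 𝓕.IsDefiningOn U f)
    (hr0 : r ≠ 0) (hreg : U ⊆ 𝓕.regular) (hi₀ : i₀.val + 1 = n) (hk : k + 1 = n)
    (hφ : IsDistinguished r 𝓕.leaf 𝓕.dim k φ) (hsub : φ.source ⊆ U) {a b : Fin n → ℝ}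
    (hab : φ.target = {z | ∀ i, z i ∈ Ioo (a i) (b i)}) {p : Eu n} (hp : p ∈ φ.target) {x : M}
    (hx : x ∈ φ.source) : deriv (profile φ i₀ p f) (φ x i₀) ≠ 0 := by
  intro h0
  refine hf.diff_ne_zero x (hsub hx) (show diffAt f x = 0 from ContinuousLinearMap.ext fun v => ?_)
  rw [diffAt_eq_profile hr0 hφ.mem_atlas hab hp (hf.contMDiffOn.mono hsub)
    (fun y hy z hz => hf.eq_of_slice hreg hi₀ hk hφ hsub hy hz) hx v, h0, zero_mul]
  rfl

/-- Each ingredient of `laplacian_eq_of_unit` is constant on slices: `|∇f|` by the Riemannian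
condition, `div ν` by constant mean curvature, and `∇f(|∇f|²)` by `hder`. -/
theorem SingularFoliation.IsDefiningOn.laplacian_eq_of_slice (hf : 𝓕.IsDefiningOn U f)
    (hr1 : r + 1 ≤ r) (hr2 : 2 ≤ r) (hU : IsOpen U) (hreg : U ⊆ 𝓕.regular)
    (hriem : 𝓕.IsRiemannian g) (hcmc : 𝓕.HasConstantMeanCurvature g) (hi₀ : i₀.val + 1 = n)
    (hk : k + 1 = n) (hφ : IsDistinguished r 𝓕.leaf 𝓕.dim k φ) (hsub : φ.source ⊆ U) {y z : M}
    (hy : y ∈ φ.source) (hz : z ∈ φ.source) (hyz : φ y i₀ = φ z i₀) :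
    laplacian g f y = laplacian g f z := by
  have hr0 : r ≠ 0 := by rintro rfl; simp at hr2
  have hS : ∀ y ∈ φ.source, ∀ z ∈ φ.source, φ y i₀ = φ z i₀ → gradSq g f y = gradSq g f z :=
    fun y hy z hz => hf.gradSq_eq_of_slice g hr1 hr2 hU hreg hriem hi₀ hk hφ hsub hy hz
  obtain ⟨a, b, hab⟩ := hφ.box
  have hp := φ.map_source hy
  -- Both `|∇f|²` and `f` factor through the coordinate `i₀`. Evaluating their differentials on `∇f`
  -- and eliminating the `i₀`-component of `∇f` leaves a function of that coordinate.
  have hder : ∀ x ∈ φ.source, diffAt (gradSq g f) x (grad g f x) =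
      deriv (profile φ i₀ (φ y) (gradSq g f)) (φ x i₀) / deriv (profile φ i₀ (φ y) f) (φ x i₀)
        * gradSq g f x := by
    intro x hx
    have hne := hf.deriv_profile_ne_zero hr0 hreg hi₀ hk hφ hsub hab hp hx
    have e1 := diffAt_eq_profile hr0 hφ.mem_atlas hab hp
      ((contMDiffOn_gradSq g hr1 hr0 hU hf.contMDiffOn).mono hsub) hS hx (grad g f x)
    have e2 := (gradSq_eq_diffAt g f x).trans
      (diffAt_eq_profile hr0 hφ.mem_atlas hab hp (hf.contMDiffOn.mono hsub)
        (fun y hy z hz => hf.eq_of_slice hreg hi₀ hk hφ hsub hy hz) hx (grad g f x))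
    rw [e2]
    refine e1.trans ?_
    field_simp
  have hdiv := hcmc U _ hU hreg (hf.isUnitNormalOn g hr1 hr0 hU hreg) y (hsub hy) z (hsub hz)
    (leafIn_of_slice hreg hi₀ hk hφ hsub hy hz hyz)
  rw [laplacian_eq_of_unit g hr1 hr0 hU hf.contMDiffOn (hsub hy) (hf.diff_ne_zero _ (hsub hy)),
    laplacian_eq_of_unit g hr1 hr0 hU hf.contMDiffOn (hsub hz) (hf.diff_ne_zero _ (hsub hz)),
    hder y hy, hder z hz, hdiv, hS y hy z hz hyz, hyz]

/-- The inverse `q` of the profile of `f` recovers the transverse coordinate from the value of `f`.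
Composing `q` with the profiles of `|∇f|²` and `Δf` gives `F` and `G`. -/
theorem SingularFoliation.IsDefiningOn.isIsoparametricOn (hf : 𝓕.IsDefiningOn U f)
    (hr1 : r + 1 ≤ r) (hr2 : 2 ≤ r) (hU : IsOpen U) (hreg : U ⊆ 𝓕.regular)
    (hriem : 𝓕.IsRiemannian g) (hcmc : 𝓕.HasConstantMeanCurvature g) (hi₀ : i₀.val + 1 = n)
    (hk : k + 1 = n) (hφ : IsDistinguished r 𝓕.leaf 𝓕.dim k φ) (hsub : φ.source ⊆ U) {x : M}
    (hx : x ∈ φ.source) : IsIsoparametricOn g r φ.source f := by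
  have hr0 : r ≠ 0 := by rintro rfl; simp at hr2
  obtain ⟨a, b, hab⟩ := hφ.box
  have hp := φ.map_source hx
  have hfs : ∀ y ∈ φ.source, ∀ z ∈ φ.source, φ y i₀ = φ z i₀ → f y = f z :=
    fun y hy z hz => hf.eq_of_slice hreg hi₀ hk hφ hsub hy hz
  have hpf := contDiffOn_profile hφ.mem_atlas hab (i₀ := i₀) hp (hf.contMDiffOn.mono hsub)
  obtain ⟨q, hq, hqinv⟩ := exists_contDiffOn_inverse hr0 hpf fun s hs => by
    have hmem := transversal_mem hab hp hs
    have := hf.deriv_profile_ne_zero hr0 hreg hi₀ hk hφ hsub hab hp (φ.map_target hmem)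
    rwa [φ.right_inv hmem, transversal_self] at this
  have himg : f '' φ.source ⊆ profile φ i₀ (φ x) f '' Ioo (a i₀) (b i₀) := by
    rintro _ ⟨y, hy, rfl⟩
    exact ⟨φ y i₀, coord_mem hab i₀ hy, (eq_profile hab hp hfs hy).symm⟩
  have hqf : ∀ y ∈ φ.source, q (f y) = φ y i₀ := fun y hy => by
    rw [eq_profile hab hp hfs hy]
    exact hqinv _ (coord_mem hab i₀ hy)
  have hmaps : MapsTo q (f '' φ.source) (Ioo (a i₀) (b i₀)) := by
    rintro _ ⟨y, hy, rfl⟩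
    rw [hqf y hy]
    exact coord_mem hab i₀ hy
  refine ⟨fun t => profile φ i₀ (φ x) (gradSq g f) (q t),
    fun t => profile φ i₀ (φ x) (laplacian g f) (q t), ?_, ?_, fun y hy => ⟨?_, ?_⟩⟩
  · exact (contDiffOn_profile hφ.mem_atlas hab hp
      ((contMDiffOn_gradSq g hr1 hr0 hU hf.contMDiffOn).mono hsub)).comp (hq.mono himg) hmaps
  · exact (contDiffOn_profile hφ.mem_atlas hab hp
      ((contMDiffOn_laplacian g hr1 hr0 hU hf.contMDiffOn).mono hsub)).comp (hq.mono himg) hmaps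
  · change _ = profile φ i₀ (φ x) (gradSq g f) (q (f y))
    rw [hqf y hy]
    exact eq_profile hab hp (fun y hy z hz =>
      hf.gradSq_eq_of_slice g hr1 hr2 hU hreg hriem hi₀ hk hφ hsub hy hz) hy
  · change _ = profile φ i₀ (φ x) (laplacian g f) (q (f y))
    rw [hqf y hy]
    exact eq_profile hab hp (fun y hy z hz =>
      hf.laplacian_eq_of_slice g hr1 hr2 hU hreg hriem hcmc hi₀ hk hφ hsub hy hz) hy

theorem SingularFoliation.IsDefiningOn.isEquilibriumOn (hf : 𝓕.IsDefiningOn U f)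
    (hr1 : r + 1 ≤ r) (hr2 : 2 ≤ r) (hU : IsOpen U) (hreg : U ⊆ 𝓕.regular)
    (hriem : 𝓕.IsRiemannian g) (hcmc : 𝓕.HasConstantMeanCurvature g) :
    IsEquilibriumOn g r U f where
  contMDiffOn := hf.contMDiffOn
  gradSq_eq y hy z hz := by
    have hzU := (connectedComponentIn_subset _ _ hz).1
    refine (eq_of_leafIn_of_slice hreg (fun k i₀ φ hi₀ hk hφ hsub y hy z hz =>
      hf.gradSq_eq_of_slice g hr1 hr2 hU hreg hriem hi₀ hk hφ hsub hy hz)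
      ((hf.represents y hy z hzU).2 hz)).symm
  laplacian_eq y hy z hz := by
    have hzU := (connectedComponentIn_subset _ _ hz).1
    refine (eq_of_leafIn_of_slice hreg (fun k i₀ φ hi₀ hk hφ hsub y hy z hz =>
      hf.laplacian_eq_of_slice g hr1 hr2 hU hreg hriem hcmc hi₀ hk hφ hsub hy hz)
      ((hf.represents y hy z hzU).2 hz)).symm

/-- The transverse coordinate of a distinguished chart of codimension one is a defining
function. -/
theorem isDefiningOn_transverse_coord (hr0 : r ≠ 0) (hreg : φ.source ⊆ 𝓕.regular)
    (hi₀ : i₀.val + 1 = n) (hk : k + 1 = n) (hφ : IsDistinguished r 𝓕.leaf 𝓕.dim k φ) :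
    𝓕.IsDefiningOn φ.source (fun y => φ y i₀) where
  contMDiffOn := by
    have hrM : IsManifold 𝓘(ℝ, Eu n) r M := IsManifold.of_le (n := ω) le_top
    exact ((EuclideanSpace.proj i₀ : Eu n →L[ℝ] ℝ).contDiff.contMDiff).comp_contMDiffOn
      (contMDiffOn_of_mem_maximalAtlas hφ.mem_atlas)
  diff_ne_zero x hx := by
    intro h0
    have hd := hφ.mdifferentiable hr0
    have h2 : HasMFDerivAt 𝓘(ℝ, Eu n) 𝓘(ℝ, ℝ) (fun y => φ y i₀) x
        ((EuclideanSpace.proj i₀ : Eu n →L[ℝ] ℝ) ∘L chartDeriv φ x) :=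
      (EuclideanSpace.proj i₀ : Eu n →L[ℝ] ℝ).hasMFDerivAt.comp x
        (hd.mdifferentiableAt hx).hasMFDerivAt
    have h3 : (EuclideanSpace.proj i₀ : Eu n →L[ℝ] ℝ) ∘L chartDeriv φ x = 0 := h2.mfderiv.symm.trans h0
    have h4 := congrArg (fun A : Eu n →L[ℝ] ℝ =>
      A (chartSymmDeriv φ (φ x) (EuclideanSpace.single i₀ 1))) h3
    have h5 := chartDeriv_chartSymmDeriv hd (φ.map_source hx) (EuclideanSpace.single i₀ 1)
    rw [φ.left_inv hx] at h5
    simp [h5] at h4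
  represents := by
    intro y hy z hz
    constructor
    · intro h
      -- The plaques of a chain may belong to other charts inside `φ.source`; by the countability
      -- argument each of them still lies in a single slice of `φ`.
      have heq : φ y i₀ = φ z i₀ := by
        refine eq_of_leafIn_of_slice hreg (F := fun p => φ p i₀)
          (fun k' i₁ ψ hi₁ hk' hψ hsub p hp q hq hpq => ?_) h
        have hdim : 𝓕.dim p = k := by have : 𝓕.dim p + 1 = n := hreg (hsub hp); omega
        exact (transverse_eq_iff φ hi₀ hk).1
          (transverse_const_on_slice hψ hφ hi₁ hk' hsub hp hq hdim hpq)
      exact (isPreconnected_slice hφ.box i₀ (φ y i₀)).subset_connectedComponentIn ⟨hy, rfl⟩ le_rfl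
        ⟨hz, heq.symm⟩
    · intro h
      exact leafIn_of_slice hreg hi₀ hk hφ le_rfl hy hz
        ((connectedComponentIn_subset _ _ h).2 : φ z i₀ = φ y i₀).symm

end Equilibrium

end RiemFol

end

/-! ### The main theorem -/

open RiemFol
theorem mainTheorem6 {n : ℕ} {r : WithTop ℕ∞} (hr : r = ∞ ∨ r = ω)
    {M : Type*} [TopologicalSpace M] [T2Space M] [SecondCountableTopology M]
    [ChartedSpace (Eu n) M] [IsManifold 𝓘(ℝ, Eu n) ω M]
    (g : RiemFol.Metric n M) (𝓕 : SingularFoliation n r M)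
    (hcodim : 𝓕.IsCodimOne) (hriem : 𝓕.IsRiemannian g) (hcmc : 𝓕.HasConstantMeanCurvature g) :
    (∀ x ∈ 𝓕.regular, ∃ U : Set M, IsOpen U ∧ x ∈ U ∧ U ⊆ 𝓕.regular ∧
      ∃ f : M → ℝ, 𝓕.IsDefiningOn U f ∧ IsEquilibriumOn g r U f ∧ IsIsoparametricOn g r U f) ∧
    (∀ U : Set M, IsOpen U → U ⊆ 𝓕.regular → ∀ f : M → ℝ, 𝓕.IsDefiningOn U f →
      IsEquilibriumOn g r U f ∧
      ∀ x ∈ U, ∃ V : Set M, IsOpen V ∧ x ∈ V ∧ V ⊆ U ∧ IsIsoparametricOn g r V f) := by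
  have hr1 : r + 1 ≤ r := by rcases hr with rfl | rfl <;> exact le_rfl
  have hr2 : 2 ≤ r := by
    rcases hr with rfl | rfl
    · exact WithTop.coe_le_coe.2 le_top
    · exact le_top
  have hr0 : r ≠ 0 := by rintro rfl; simp at hr2
  constructor
  · intro x hx
    have hk : 𝓕.dim x + 1 = n := hx
    obtain ⟨φ, hφ, hxφ⟩ := 𝓕.exists_chart x
    -- No singular leaf meets a distinguished chart of codimension one, so the whole chart domain
    -- can serve as `U`.
    have hreg : φ.source ⊆ 𝓕.regular := fun y hy => by
      change 𝓕.dim y + 1 = n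
      rw [dim_eq_of_isDistinguished 𝓕 hr0 hcodim hk hφ hy, hk]
    have hi₀ : (⟨𝓕.dim x, by omega⟩ : Fin n).val + 1 = n := hk
    have hf := isDefiningOn_transverse_coord hr0 hreg hi₀ hk hφ
    exact ⟨φ.source, φ.open_source, hxφ, hreg, _, hf,
      hf.isEquilibriumOn g hr1 hr2 φ.open_source hreg hriem hcmc,
      hf.isIsoparametricOn g hr1 hr2 φ.open_source hreg hriem hcmc hi₀ hk hφ le_rfl hxφ⟩
  · intro U hU hreg f hf
    refine ⟨hf.isEquilibriumOn g hr1 hr2 hU hreg hriem hcmc, fun x hx => ?_⟩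
    have hk : 𝓕.dim x + 1 = n := hreg hx
    have hi₀ : (⟨𝓕.dim x, by omega⟩ : Fin n).val + 1 = n := hk
    obtain ⟨φ, hφ, hxφ⟩ := 𝓕.exists_chart x
    obtain ⟨φ', hφ', hxφ', hsub, -⟩ := hφ.exists_restr hxφ hU hx
    have hsubU := hsub.trans inter_subset_right
    exact ⟨φ'.source, φ'.open_source, hxφ', hsubU,
      hf.isIsoparametricOn g hr1 hr2 hU hreg hriem hcmc hi₀ hk hφ' hsubU hxφ'⟩
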